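/- **Conventions.** Maps between topological spaces are continuous. For a point $x$ of a finite $T_0$-space $X$, let $U_x$ be the intersection of all open sets containing $x$, and write $x\le y$ if $x\in U_y$; this is a partial order on $X$. A map $f:X\to Y$ between finite $T_0$-spaces is *distinguished* if $f^{-1}(U_y)$ is contractible for every $y\in Y$. Let $\overline{\mathcal D}$ be the smallest class of maps between finite $T_0$-spaces that contains all distinguished maps and has the 2-out-of-3 property up to homotopy: whenever $f\circ g\simeq h$ and two of the maps $f,g,h$ are in the class, so is the third. For a finite $T_0$-space $X$, $\mathcal K(X)$ is the simplicial complex whose simplices are the non-empty chains of $X$, and for $f:X\to Y$ the simplicial map $\mathcal K(f):\mathcal K(X)\to\mathcal K(Y)$ coincides with $f$ on vertices. For a finite simplicial complex $K$, $\mathcal X(K)$ is the finite $T_0$-space given by the set of simplices of $K$ ordered by inclusion (the open sets are the lower sets), and for a simplicial map $\varphi:K\to L$ the map $\mathcal X(\varphi):\mathcal X(K)\to\mathcal X(L)$ sends $S$ to $\varphi(S)$. Geometric realization is denoted by $|\cdot|$. There is an *elementary collapse* from a finite simplicial complex $K$ to a subcomplex $L$ if there are a simplex $S$ of $K$ and a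 vertex $a$ of $K$ not in $S$ with $K=L\cup aS$ and $L\cap aS=a\partial S$. A *simplicial expansion* is an injective simplicial map $L\to K$ of finite simplicial complexes such that finitely many (possibly zero) elementary collapses lead from $K$ to the image of $L$. A homotopy equivalence $|K|\to|L|$ between realizations of finite simplicial complexes is a *simple homotopy equivalence* if it is homotopic to the composition of a finite sequence of maps $|K|=|K_0|\to|K_1|\to\dots\to|K_n|=|L|$ between realizations of finite simplicial complexes, each of which is the realization of a simplicial expansion or a homotopy inverse of one. **Theorem.** (a) Let $f:X\to Y$ be a map between finite $T_0$-spaces. Then $f\in\overline{\mathcal D}$ if and only if $|\mathcal K(f)|:|\mathcal K(X)|\to|\mathcal K(Y)|$ is a simple homotopy equivalence. (b) Let $\varphi:K\to L$ be a simplicial map between finite simplicial complexes. Then $|\varphi|:|K|\to|L|$ is a simple homotopy equivalence if and only if $\mathcal X(\varphi)\in\overline{\mathcal D}$. -/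

import Mathlib

universe u

namespace SimpleHomotopy

/-! ### Finite spaces -/

/-- The minimal open set `U_x`: the intersection of all open sets containing `x`. -/
def minOpen {X : Type u} [TopologicalSpace X] (x : X) : Set X :=
  ⋂₀ {U : Set X | IsOpen U ∧ x ∈ U}

/-- A map is distinguished if the preimage of every minimal open set is contractible. -/
def IsDistinguished {X Y : Type u} [TopologicalSpace X] [TopologicalSpace Y] (f : C(X, Y)) :
    Prop :=
  ∀ y : Y, ContractibleSpace (f ⁻¹' minOpen y)

/-- A class of continuous maps between finite T₀-spaces. -/
abbrev MapClass : Type (u + 1) :=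
  ∀ (X Y : Type u) [TopologicalSpace X] [Finite X] [T0Space X]
    [TopologicalSpace Y] [Finite Y] [T0Space Y], C(X, Y) → Prop

/-- The class of distinguished maps between finite T₀-spaces. -/
def distinguishedMaps : MapClass.{u} :=
  fun _ _ _ _ _ _ _ _ f => IsDistinguished f

/-- The class generated by `C`: the smallest class of maps between finite T₀-spaces which contains
`C` and has the 2-out-of-3 property up to homotopy, that is, whenever `f ∘ g ≃ h` and two of
`f`, `g`, `h` are in the class, so is the third. -/
inductive Generated (C : MapClass.{u}) :
    ∀ {X Y : Type u} [TopologicalSpace X] [Finite X] [T0Space X]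
      [TopologicalSpace Y] [Finite Y] [T0Space Y], C(X, Y) → Prop
  | base {X Y : Type u} [TopologicalSpace X] [Finite X] [T0Space X]
      [TopologicalSpace Y] [Finite Y] [T0Space Y] {f : C(X, Y)} :
      C X Y f → Generated C f
  | comp {X Y Z : Type u} [TopologicalSpace X] [Finite X] [T0Space X]
      [TopologicalSpace Y] [Finite Y] [T0Space Y] [TopologicalSpace Z] [Finite Z] [T0Space Z]
      {f : C(Y, Z)} {g : C(X, Y)} {h : C(X, Z)} :
      (f.comp g).Homotopic h → Generated C f → Generated C g → Generated C h
  | left {X Y Z : Type u} [TopologicalSpace X] [Finite X] [T0Space X]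
      [TopologicalSpace Y] [Finite Y] [T0Space Y] [TopologicalSpace Z] [Finite Z] [T0Space Z]
      {f : C(Y, Z)} {g : C(X, Y)} {h : C(X, Z)} :
      (f.comp g).Homotopic h → Generated C g → Generated C h → Generated C f
  | right {X Y Z : Type u} [TopologicalSpace X] [Finite X] [T0Space X]
      [TopologicalSpace Y] [Finite Y] [T0Space Y] [TopologicalSpace Z] [Finite Z] [T0Space Z]
      {f : C(Y, Z)} {g : C(X, Y)} {h : C(X, Z)} :
      (f.comp g).Homotopic h → Generated C f → Generated C h → Generated C g

/-- The class `D̄` generated by the distinguished maps. -/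
def InDBar {X Y : Type u} [TopologicalSpace X] [Finite X] [T0Space X]
    [TopologicalSpace Y] [Finite Y] [T0Space Y] (f : C(X, Y)) : Prop :=
  Generated distinguishedMaps.{u} f

/-! ### Simplicial complexes, simplicial maps, geometric realization -/

open Classical in
/-- A simplicial map: a map of vertices that sends simplices to simplices. -/
structure SimplicialMap {V W : Type u} (K : AbstractSimplicialComplex V)
    (L : AbstractSimplicialComplex W) where
  toFun : V → W
  image_mem : ∀ s ∈ K, s.image toFun ∈ L

/-- The geometric realization `|K|`: functions on the vertices with non-negative values of sum one
(barycentric coordinates) that are supported in a simplex of `K`. It carries the subspace topology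
of the standard simplex. -/
abbrev Realization {V : Type u} [Fintype V] (K : AbstractSimplicialComplex V) : Type u :=
  {x : stdSimplex ℝ V // ∃ s ∈ K, ∀ v, x v ≠ 0 → v ∈ s}

open Classical in
/-- The map `|φ| : |K| → |L|` induced by a simplicial map, affine on each simplex. -/
noncomputable def SimplicialMap.realization {V W : Type u} [Fintype V] [Fintype W]
    {K : AbstractSimplicialComplex V} {L : AbstractSimplicialComplex W} (φ : SimplicialMap K L) :
    C(Realization K, Realization L) where
  toFun x := ⟨stdSimplex.map φ.toFun x.1, by
    obtain ⟨x, s, hs, hx⟩ := x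
    refine ⟨s.image φ.toFun, φ.image_mem s hs, fun w hw => ?_⟩
    rw [stdSimplex.map_coe, FunOnFinite.linearMap_apply_apply] at hw
    obtain ⟨v, hv, hne⟩ := Finset.exists_ne_zero_of_sum_ne_zero hw
    exact Finset.mem_image.2 ⟨v, hx v hne, by simpa using hv⟩⟩
  continuous_toFun :=
    ((stdSimplex.continuous_map φ.toFun).comp continuous_subtype_val).subtype_mk _

/-! ### Simplicial collapses and simple homotopy equivalences -/

/-- The complex of all faces of the simplex with vertex set `s`. -/
def simplex {V : Type u} (s : Finset V) : PreAbstractSimplicialComplex V where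
  faces := {t | t.Nonempty ∧ t ⊆ s}
  isRelLowerSet_faces := fun _ ht => ⟨ht.1, fun _ hb hne => ⟨hne, hb.trans ht.2⟩⟩

open Classical in
/-- The cone with apex `a` over the boundary of the simplex `S`, where `a ∉ S`: the faces of the
simplex `aS` which do not contain `S`. -/
def coneBoundary {V : Type u} (a : V) (S : Finset V) : PreAbstractSimplicialComplex V where
  faces := {t | t.Nonempty ∧ t ⊆ insert a S ∧ ¬ S ⊆ t}
  isRelLowerSet_faces := fun _ ht =>
    ⟨ht.1, fun _ hb hne => ⟨hne, hb.trans ht.2.1, fun h => ht.2.2 (h.trans hb)⟩⟩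

open Classical in
/-- Elementary simplicial collapse of `K` to `L`: for some simplex `S` and vertex `a ∉ S` of `K`,
one has `K = L ∪ aS` and `L ∩ aS = a ∂S`. -/
def ElementaryCollapse {V : Type u} (K L : PreAbstractSimplicialComplex V) : Prop :=
  ∃ S ∈ K, ∃ a : V, {a} ∈ K ∧ a ∉ S ∧
    K = L ⊔ simplex (insert a S) ∧ L ⊓ simplex (insert a S) = coneBoundary a S

/-- `K` collapses to `L` by finitely many elementary collapses. -/
def Collapses {V : Type u} (K L : PreAbstractSimplicialComplex V) : Prop :=
  Relation.ReflTransGen ElementaryCollapse K L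

open Classical in
/-- A simplicial expansion: an injective simplicial map `i : L → K` which identifies `L` with a
subcomplex of `K` to which `K` collapses. -/
def IsExpansion {V W : Type u} {L : AbstractSimplicialComplex V} {K : AbstractSimplicialComplex W}
    (i : SimplicialMap L K) : Prop :=
  Function.Injective i.toFun ∧
    Collapses K.toPreAbstractSimplicialComplex (L.toPreAbstractSimplicialComplex.map i.toFun)

/-- Finite compositions `|K| → |K₁| → ⋯ → |L|` in which each map is a simplicial expansion or a
homotopy inverse of one; all complexes are finite. -/
inductive IsDeformation : ∀ {V W : Type u} [Fintype V] [Fintype W]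
    {K : AbstractSimplicialComplex V} {L : AbstractSimplicialComplex W},
    C(Realization K, Realization L) → Prop
  | refl {V : Type u} [Fintype V] (K : AbstractSimplicialComplex V) :
      IsDeformation (ContinuousMap.id (Realization K))
  | expansion {V W Z : Type u} [Fintype V] [Fintype W] [Fintype Z]
      {K : AbstractSimplicialComplex V} {L : AbstractSimplicialComplex W}
      {M : AbstractSimplicialComplex Z} {f : C(Realization K, Realization L)}
      (i : SimplicialMap L M) :
      IsExpansion i → IsDeformation f → IsDeformation (i.realization.comp f)
  | inverse {V W Z : Type u} [Fintype V] [Fintype W] [Fintype Z]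
      {K : AbstractSimplicialComplex V} {L : AbstractSimplicialComplex W}
      {M : AbstractSimplicialComplex Z} {f : C(Realization K, Realization L)}
      (i : SimplicialMap M L) (r : C(Realization L, Realization M)) :
      IsExpansion i →
      (r.comp i.realization).Homotopic (ContinuousMap.id (Realization M)) →
      (i.realization.comp r).Homotopic (ContinuousMap.id (Realization L)) →
      IsDeformation f → IsDeformation (r.comp f)

/-- A simple homotopy equivalence `|K| → |L|`: a homotopy equivalence which is homotopic to a
finite composition of simplicial expansions and homotopy inverses of such. -/
def IsSimpleHomotopyEquiv {V W : Type u} [Fintype V] [Fintype W]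
    {K : AbstractSimplicialComplex V} {L : AbstractSimplicialComplex W}
    (f : C(Realization K, Realization L)) : Prop :=
  (∃ e : ContinuousMap.HomotopyEquiv (Realization K) (Realization L), e.toFun = f) ∧
    ∃ g : C(Realization K, Realization L), IsDeformation g ∧ f.Homotopic g

/-! ### The functor `K` from finite spaces to simplicial complexes -/

theorem minOpen_map {X Y : Type u} [TopologicalSpace X] [TopologicalSpace Y] (f : C(X, Y))
    {x y : X} (h : x ∈ minOpen y) : f x ∈ minOpen (f y) :=
  fun U hU => h (f ⁻¹' U) ⟨hU.1.preimage f.continuous, hU.2⟩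

/-- The complex `K(X)` of non-empty finite chains of `X`, where `x ≤ y` means `x ∈ U_y`. -/
def orderComplex (X : Type u) [TopologicalSpace X] : AbstractSimplicialComplex X where
  faces := {s | s.Nonempty ∧ IsChain (fun x y => x ∈ minOpen y) (s : Set X)}
  isRelLowerSet_faces := fun _ hs =>
    ⟨hs.1, fun _ hb hne => ⟨hne, hs.2.mono (by exact_mod_cast hb)⟩⟩
  singleton_mem v := ⟨Finset.singleton_nonempty v, by simp [IsChain]⟩

open Classical in
/-- The simplicial map `K(f)`, which coincides with `f` on vertices. -/
def orderComplexMap {X Y : Type u} [TopologicalSpace X] [TopologicalSpace Y] (f : C(X, Y)) :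
    SimplicialMap (orderComplex X) (orderComplex Y) where
  toFun := f
  image_mem := fun s hs => by
    refine ⟨hs.1.image f, ?_⟩
    rw [Finset.coe_image]
    rintro _ ⟨x, hx, rfl⟩ _ ⟨y, hy, rfl⟩ hne
    have hxy : x ≠ y := fun h => hne (congrArg f h)
    exact (hs.2 hx hy hxy).imp (minOpen_map f) (minOpen_map f)

/-! ### The functor `X` from finite simplicial complexes to finite spaces -/

/-- The poset `X(K)` of simplices of `K`, ordered by inclusion. -/
def FaceSpace {V : Type u} (K : AbstractSimplicialComplex V) : Type u :=
  {s : Finset V // s ∈ K}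

instance {V : Type u} (K : AbstractSimplicialComplex V) : PartialOrder (FaceSpace K) :=
  inferInstanceAs (PartialOrder {s : Finset V // s ∈ K})

/-- The topology of the poset `X(K)`, in which the minimal open set of `S` is `{T | T ≤ S}`. -/
instance {V : Type u} (K : AbstractSimplicialComplex V) : TopologicalSpace (FaceSpace K) :=
  Topology.lowerSet (FaceSpace K)

instance {V : Type u} [Finite V] (K : AbstractSimplicialComplex V) : Finite (FaceSpace K) :=
  inferInstanceAs (Finite {s : Finset V // s ∈ K})

theorem minOpen_faceSpace {V : Type u} (K : AbstractSimplicialComplex V) (S : FaceSpace K) :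
    minOpen S = {T : FaceSpace K | T ≤ S} := by
  apply Set.Subset.antisymm
  · exact fun T hT => hT {T | T ≤ S} ⟨fun _ _ hba ha => le_trans hba ha, le_refl S⟩
  · exact fun T hT U hU => hU.1 hT hU.2

instance {V : Type u} (K : AbstractSimplicialComplex V) : T0Space (FaceSpace K) where
  t0 := fun S T h => by
    have key : ∀ A B : FaceSpace K, Inseparable A B → A ≤ B := fun A B hAB =>
      (hAB.mem_open_iff (s := {C : FaceSpace K | C ≤ B})
        (fun _ _ hba ha => le_trans hba ha)).2 (le_refl B)
    exact le_antisymm (key S T h) (key T S h.symm)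

open Classical in
/-- The continuous map `X(φ)`, `S ↦ φ(S)`. -/
noncomputable def faceSpaceMap {V W : Type u} {K : AbstractSimplicialComplex V}
    {L : AbstractSimplicialComplex W} (φ : SimplicialMap K L) :
    C(FaceSpace K, FaceSpace L) where
  toFun S := ⟨S.1.image φ.toFun, φ.image_mem S.1 S.2⟩
  continuous_toFun := ⟨fun _ hU _ _ hba ha => hU (Finset.image_subset_image hba) ha⟩

end SimpleHomotopy

/-!
A distinguished map `f : X → Y` has a mapping cylinder, the poset `X ⊔ Y` with `x ≤ y` when
`f x ≤ y`. Each `f ⁻¹' U_y` is dismantlable, that is, it can be reduced to a point by removing beat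
points, and it is a join factor of the link of `y` in the order complex of the cylinder once the
points below `y` in `Y` are gone, so that removing `y` amounts to a sequence of collapses. Hence
that order complex collapses onto those of `X` and of `Y`, and `|𝒦(f)|` is a simple homotopy
equivalence. The order complex of the face poset of `K` is the barycentric subdivision of `K`, and a
similar cylinder relates it to `K`, so that `|φ|` is a simple homotopy equivalence as soon as `𝒳(φ)`
lies in the class.

Conversely, the face poset functor sends an elementary collapse to the removal of a beat point
followed by a distinguished inclusion, and contiguous simplicial maps to homotopic maps. Homotopy
inverses of expansions are not simplicial, but up to homotopy and subdivision every map of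
realizations is, by simplicial approximation; the subdivisions do no harm because a simplicial
approximation of the identity from the barycentric subdivision to `K` induces a map of face posets
which lies in the class. Finally, the maximum of a chain defines a distinguished map
`𝒳(𝒦(X)) → X`, natural up to homotopy, which transports the result from simplicial maps to maps of
finite spaces.
-/

open Topology unitInterval

namespace SimpleHomotopy

/-! ### Finite spaces and the specialization order -/

section FiniteSpaces

variable {X Y : Type u} [TopologicalSpace X] [TopologicalSpace Y]

theorem mem_minOpen_iff {x y : X} : x ∈ minOpen y ↔ x ⤳ y := by
  rw [specializes_iff_forall_open]
  exact ⟨fun h s hs hy => h s ⟨hs, hy⟩, fun h s hs => h s hs.1 hs.2⟩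

theorem FaceSpace.specializes_iff {V : Type u} {K : AbstractSimplicialComplex V}
    {S T : FaceSpace K} : S ⤳ T ↔ S.1 ⊆ T.1 := by
  rw [← mem_minOpen_iff, minOpen_faceSpace]
  exact Iff.rfl

theorem subtype_specializes_iff {p : X → Prop} {x y : Subtype p} : x ⤳ y ↔ x.1 ⤳ y.1 :=
  IsInducing.subtypeVal.specializes_iff.symm

theorem continuous_of_specializes [AlexandrovDiscrete X] {f : X → Y}
    (h : ∀ x y, x ⤳ y → f x ⤳ f y) : Continuous f :=
  ⟨fun _ hU => isOpen_iff_forall_specializes.2 fun x y hxy hy => (h x y hxy).mem_open hU hy⟩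

open Classical in
/-- Two pointwise comparable maps `f ⤳ g` as a single map out of the product with the Sierpiński
space `Prop`, whose open point is `True`: the map is `f` at `True` and `g` at `False`. -/
noncomputable def sierpinskiHomotopy (f g : C(X, Y)) (h : ∀ x, f x ⤳ g x) : C(X × Prop, Y) where
  toFun p := if p.2 then f p.1 else g p.1
  continuous_toFun := by
    refine ⟨fun U hU => ?_⟩
    have hpre : (fun p : X × Prop => if p.2 then f p.1 else g p.1) ⁻¹' U =
        (f ⁻¹' U) ×ˢ {True} ∪ (g ⁻¹' U) ×ˢ Set.univ := by
      ext ⟨x, p⟩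
      by_cases hp : p
      · simpa [hp] using fun hx => (h x).mem_open hU hx
      · simp [hp]
    rw [hpre]
    exact ((hU.preimage f.continuous).prod isOpen_singleton_true).union
      ((hU.preimage g.continuous).prod isOpen_univ)

theorem sierpinskiHomotopy_true {f g : C(X, Y)} (h : ∀ x, f x ⤳ g x) (x : X) :
    sierpinskiHomotopy f g h (x, True) = f x :=
  if_pos trivial

theorem sierpinskiHomotopy_false {f g : C(X, Y)} (h : ∀ x, f x ⤳ g x) (x : X) :
    sierpinskiHomotopy f g h (x, False) = g x :=
  if_neg id

theorem homotopic_of_specializes {f g : C(X, Y)} (h : ∀ x, f x ⤳ g x) : f.Homotopic g := by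
  have hlt : Continuous fun t : I => t ≠ 1 := continuous_Prop.2 isOpen_compl_singleton
  let τ : C(I × X, X × Prop) :=
    ⟨fun p => (p.2, p.1 ≠ 1), continuous_snd.prodMk (hlt.comp continuous_fst)⟩
  refine ⟨⟨(sierpinskiHomotopy f g h).comp τ, fun x => ?_, fun x => ?_⟩⟩
  · exact if_pos zero_ne_one
  · exact if_neg fun hne => hne rfl

/-- In the compact-open topology the maps below a given one form a neighbourhood of it, so a path
of maps is locally constant modulo comparability. -/
theorem eqvGen_of_homotopic [Finite X] [Finite Y] {f g : C(X, Y)} (h : f.Homotopic g) :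
    Relation.EqvGen (fun f g : C(X, Y) => ∀ x, f x ⤳ g x) f g := by
  obtain ⟨H⟩ := h
  let q : I → Quot fun f g : C(X, Y) => ∀ x, f x ⤳ g x := fun t => Quot.mk _ (H.curry t)
  have hq : IsLocallyConstant q := by
    rw [IsLocallyConstant.iff_eventually_eq]
    intro t
    have hnear : ∀ᶠ s in 𝓝 t, ∀ x, H (s, x) ⤳ H (t, x) := by
      rw [Filter.eventually_all]
      intro x
      have hcont : Continuous fun s : I => H (s, x) := by fun_prop
      have hopen : IsOpen {y : Y | y ⤳ H (t, x)} :=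
        isOpen_iff_forall_specializes.2 fun _ _ hab hb => hab.trans hb
      exact hcont.continuousAt.eventually (hopen.mem_nhds specializes_rfl)
    exact hnear.mono fun _ hs => Quot.sound hs
  simpa using Quot.eqvGen_exact (hq.apply_eq_of_preconnectedSpace 0 1)

theorem contractibleSpace_of_forall_specializes (m : X) (h : ∀ x, x ⤳ m) :
    ContractibleSpace X :=
  (contractible_iff_id_nullhomotopic X).2 ⟨m, homotopic_of_specializes h⟩

theorem contractibleSpace_of_fence (g : C(X, X)) (m : X) (hid : ∀ x, x ⤳ g x)
    (hm : ∀ x, m ⤳ g x) : ContractibleSpace X :=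
  (contractible_iff_id_nullhomotopic X).2 ⟨m, (homotopic_of_specializes (g := g) hid).trans
    (homotopic_of_specializes (f := ContinuousMap.const X m) hm).symm⟩

theorem isDistinguished_iff {f : C(X, Y)} :
    IsDistinguished f ↔ ∀ y, ContractibleSpace {x // f x ⤳ y} := by
  refine forall_congr' fun y => Homeomorph.contractibleSpace_iff ?_
  exact (Homeomorph.refl X).subtype fun x => mem_minOpen_iff

theorem isDistinguished_of_adjoint {f : C(X, Y)} (r : Y → X)
    (h : ∀ x y, f x ⤳ y ↔ x ⤳ r y) : IsDistinguished f :=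
  isDistinguished_iff.2 fun y =>
    contractibleSpace_of_forall_specializes ⟨r y, (h _ _).2 specializes_rfl⟩ fun x =>
      subtype_specializes_iff.2 ((h _ _).1 x.2)

theorem isDistinguished_fst_prop : IsDistinguished (⟨Prod.fst, continuous_fst⟩ : C(X × Prop, X)) :=
  isDistinguished_of_adjoint (fun x => (x, False)) fun p x => by
    rw [← Prod.mk.eta (p := p), specializes_prod]
    simp [Specializes, nhds_false]

end FiniteSpaces

section Closure

variable {X Y Z : Type u} [TopologicalSpace X] [Finite X] [T0Space X]
  [TopologicalSpace Y] [Finite Y] [T0Space Y] [TopologicalSpace Z] [Finite Z] [T0Space Z]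

theorem InDBar.of_isDistinguished {f : C(X, Y)} (h : IsDistinguished f) : InDBar f :=
  Generated.base h

theorem InDBar.of_adjoint {f : C(X, Y)} (r : Y → X) (h : ∀ x y, f x ⤳ y ↔ x ⤳ r y) :
    InDBar f :=
  .of_isDistinguished (isDistinguished_of_adjoint r h)

theorem InDBar.id : InDBar (ContinuousMap.id X) :=
  .of_adjoint (fun x => x) fun _ _ => Iff.rfl

theorem InDBar.comp {f : C(Y, Z)} {g : C(X, Y)} (hf : InDBar f) (hg : InDBar g) :
    InDBar (f.comp g) :=
  Generated.comp (.refl _) hf hg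

theorem InDBar.congr {f g : C(X, Y)} (h : f.Homotopic g) (hf : InDBar f) : InDBar g :=
  Generated.comp (f := f) (g := ContinuousMap.id X) h hf InDBar.id

theorem InDBar.of_comp_left {f : C(Y, Z)} {g : C(X, Y)} (hg : InDBar g)
    (h : InDBar (f.comp g)) : InDBar f :=
  Generated.left (.refl _) hg h

theorem InDBar.of_comp_right {f : C(Y, Z)} {g : C(X, Y)} (hf : InDBar f)
    (h : InDBar (f.comp g)) : InDBar g :=
  Generated.right (.refl _) hf h

end Closure

/-! ### Beat points -/

/-- Sets which are reduced to a point by successively removing a point `x` that is dominated by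
another point `z`, in the sense that everything related to `x` is related to `z`. -/
inductive Dismantlable {V : Type u} (r : V → V → Prop) : Set V → Prop
  | single (p : V) : Dismantlable r {p}
  | step {D : Set V} {x z : V} : x ∈ D → z ∈ D → z ≠ x → (∀ w ∈ D, r w x → r w z) →
      Dismantlable r (D \ {x}) → Dismantlable r D

theorem Dismantlable.image {V W : Type u} {r : V → V → Prop} {r' : W → W → Prop} {D : Set V}
    (h : Dismantlable r D) {e : V → W} (he : Function.Injective e)
    (hr : ∀ a b, r' (e a) (e b) ↔ r a b) : Dismantlable r' (e '' D) := by
  induction h with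
  | single p => rw [Set.image_singleton]; exact .single _
  | @step D x z hx hz hzx hdom _ ih =>
    refine .step (Set.mem_image_of_mem e hx) (Set.mem_image_of_mem e hz) (he.ne hzx) ?_ ?_
    · rintro _ ⟨w, hw, rfl⟩ hwx
      exact (hr _ _).2 (hdom w hw ((hr _ _).1 hwx))
    · rwa [Set.image_sdiff he, Set.image_singleton] at ih

section BeatPoints

variable {X : Type u} [TopologicalSpace X]

/-- Comparability in the specialization order. -/
def Comparable (x y : X) : Prop := x ⤳ y ∨ y ⤳ x

/-- `x` is a beat point of `X` with witness `z`: the points strictly above `x` have the minimum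
`z`, or those strictly below `x` have the maximum `z`. -/
structure IsBeatPoint (x z : X) : Prop where
  ne : z ≠ x
  comparable : Comparable x z
  below : ∀ w, w ≠ x → w ⤳ x → w ⤳ z
  above : ∀ w, w ≠ x → x ⤳ w → z ⤳ w

theorem IsBeatPoint.comparable_of_comparable {x z w : X} (h : IsBeatPoint x z)
    (hw : Comparable w x) : Comparable w z := by
  rcases eq_or_ne w x with rfl | hwx
  · exact h.comparable
  · exact hw.imp (h.below w hwx) (h.above w hwx)

theorem exists_maximal_specializes [Finite X] [T0Space X] {S : Set X} (hS : S.Nonempty) :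
    ∃ x ∈ S, ∀ y ∈ S, x ⤳ y → y = x := by
  let _ := specializationOrder X
  obtain ⟨x, hx⟩ := S.toFinite.exists_minimal hS
  exact ⟨x, hx.1, fun y hy hxy => hx.eq_of_le hy hxy⟩

theorem exists_minimal_specializes [Finite X] [T0Space X] {S : Set X} (hS : S.Nonempty) :
    ∃ x ∈ S, ∀ y ∈ S, y ⤳ x → y = x := by
  let _ := specializationOrder X
  obtain ⟨x, hx⟩ := S.toFinite.exists_maximal hS
  exact ⟨x, hx.1, fun y hy hxy => hx.eq_of_ge hy hxy⟩

theorem exists_isBeatPoint_of_ne_id [Finite X] [T0Space X] {g : C(X, X)}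
    (hg : g ≠ ContinuousMap.id X) (hid : (∀ x, x ⤳ g x) ∨ ∀ x, g x ⤳ x) :
    ∃ x z : X, IsBeatPoint x z := by
  have hmoved : {x | g x ≠ x}.Nonempty := by
    by_contra! hnone
    exact hg (ContinuousMap.ext fun x => by_contra fun hx => (hnone ▸ hx : x ∈ (∅ : Set X)))
  rcases hid with hid | hid
  · obtain ⟨x, hx, hmax⟩ := exists_maximal_specializes hmoved
    refine ⟨x, g x, hx, .inl (hid x), fun w _ hw => hw.trans (hid x), fun w hwx hw => ?_⟩
    have hfix : g w = w := by_contra fun hgw => hwx (hmax w hgw hw)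
    exact hfix ▸ hw.map g.continuous
  · obtain ⟨x, hx, hmin⟩ := exists_minimal_specializes hmoved
    refine ⟨x, g x, hx, .inr (hid x), fun w hwx hw => ?_, fun w _ hw => (hid x).trans hw⟩
    have hfix : g w = w := by_contra fun hgw => hwx (hmin w hgw hw)
    exact hfix ▸ hw.map g.continuous

theorem exists_ne_id_comparable [Finite X] {f : C(X, X)}
    (hf : (ContinuousMap.id X).Homotopic f) (hne : f ≠ ContinuousMap.id X) :
    ∃ g : C(X, X), g ≠ ContinuousMap.id X ∧ ((∀ x, x ⤳ g x) ∨ ∀ x, g x ⤳ x) := by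
  by_contra! hnone
  have hisolated : ∀ a b : C(X, X), (∀ x, a x ⤳ b x) →
      (a = ContinuousMap.id X ↔ b = ContinuousMap.id X) := by
    intro a b hab
    constructor
    · rintro rfl
      exact by_contra fun hb => (hnone b hb).1.elim fun x hx => hx (hab x)
    · rintro rfl
      exact by_contra fun ha => (hnone a ha).2.elim fun x hx => hx (hab x)
  have hclass : ∀ a b : C(X, X), Relation.EqvGen (fun a b : C(X, X) => ∀ x, a x ⤳ b x) a b →
      (a = ContinuousMap.id X ↔ b = ContinuousMap.id X) := by
    intro a b h
    induction h with
    | rel a b h => exact hisolated a b h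
    | refl => exact Iff.rfl
    | symm _ _ _ ih => exact ih.symm
    | trans _ _ _ _ _ ih₁ ih₂ => exact ih₁.trans ih₂
  exact hne ((hclass _ _ (eqvGen_of_homotopic hf)).1 rfl)

theorem exists_isBeatPoint [Finite X] [T0Space X] [ContractibleSpace X] [Nontrivial X] :
    ∃ x z : X, IsBeatPoint x z := by
  obtain ⟨p, hp⟩ := id_nullhomotopic X
  obtain ⟨q, hq⟩ := exists_ne p
  obtain ⟨g, hg, hid⟩ := exists_ne_id_comparable hp fun hid => hq (DFunLike.congr_fun hid q).symm
  exact exists_isBeatPoint_of_ne_id hg hid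

/-- The inclusion of the complement of a point. -/
def inclCompl (x : X) : C({w : X // w ≠ x}, X) := ⟨Subtype.val, continuous_subtype_val⟩

open Classical in
/-- The retraction onto the complement of a beat point `x`, which sends `x` to its witness. -/
noncomputable def IsBeatPoint.retraction [Finite X] {x z : X} (h : IsBeatPoint x z) :
    C(X, {w : X // w ≠ x}) where
  toFun w := if hw : w = x then ⟨z, h.ne⟩ else ⟨w, hw⟩
  continuous_toFun := continuous_of_specializes fun a b hab => by
    rw [subtype_specializes_iff]
    by_cases ha : a = x <;> by_cases hb : b = x
    · simp [ha, hb, specializes_rfl]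
    · simpa [ha, hb] using h.above b hb (ha ▸ hab)
    · simpa [ha, hb] using h.below a ha (hb ▸ hab)
    · simpa [ha, hb] using hab

namespace IsBeatPoint

variable [Finite X] {x z : X} (h : IsBeatPoint x z)
include h

theorem retraction_self : (h.retraction x).1 = z := by simp [retraction]

theorem retraction_of_ne {w : X} (hw : w ≠ x) : (h.retraction w).1 = w := by
  simp [retraction, hw]

theorem retraction_comp_inclCompl :
    h.retraction.comp (inclCompl x) = ContinuousMap.id {w : X // w ≠ x} := by
  ext1 w
  exact Subtype.ext (h.retraction_of_ne w.2)

theorem contractibleSpace_compl [ContractibleSpace X] : ContractibleSpace {w : X // w ≠ x} := by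
  rw [contractible_iff_id_nullhomotopic, ← h.retraction_comp_inclCompl]
  simpa using ((id_nullhomotopic X).comp_right h.retraction).comp_left (inclCompl x)

theorem inDBar_inclCompl [T0Space X] : InDBar (inclCompl x) := by
  rcases h.comparable with hxz | hzx
  · have hretraction : InDBar h.retraction := by
      refine .of_adjoint (fun w => w.1) fun w y => ?_
      rw [subtype_specializes_iff]
      rcases eq_or_ne w x with rfl | hw
      · rw [h.retraction_self]
        exact ⟨hxz.trans, h.above y.1 y.2⟩
      · rw [h.retraction_of_ne hw]
    refine hretraction.of_comp_right ?_
    rw [h.retraction_comp_inclCompl]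
    exact .id
  · refine .of_adjoint h.retraction fun w y => ?_
    rw [subtype_specializes_iff]
    rcases eq_or_ne y x with rfl | hy
    · rw [h.retraction_self]
      exact ⟨h.below w.1 w.2, fun hw => hw.trans hzx⟩
    · rw [h.retraction_of_ne hy]
      exact Iff.rfl

end IsBeatPoint

theorem dismantlable_univ {X : Type u} [TopologicalSpace X] [Finite X] [T0Space X]
    [ContractibleSpace X] : Dismantlable Comparable (Set.univ : Set X) := by
  induction hn : Nat.card X using Nat.strong_induction_on generalizing X with
  | _ n ih =>
    rcases subsingleton_or_nontrivial X with hX | hX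
    · obtain ⟨p⟩ := (inferInstance : Nonempty X)
      rw [Set.subsingleton_univ.eq_singleton_of_mem (Set.mem_univ p)]
      exact .single p
    obtain ⟨x, z, hxz⟩ := exists_isBeatPoint (X := X)
    have := hxz.contractibleSpace_compl
    have hcard : Nat.card {w : X // w ≠ x} < n :=
      hn ▸ Finite.card_subtype_lt (x := x) (not_not_intro rfl)
    have hcompl := (ih _ hcard (X := {w : X // w ≠ x}) rfl).image (r' := Comparable)
      Subtype.val_injective fun a b => or_congr subtype_specializes_iff.symm
        subtype_specializes_iff.symm
    refine .step (Set.mem_univ x) (Set.mem_univ z) hxz.ne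
      (fun w _ => hxz.comparable_of_comparable) ?_
    rwa [Set.image_univ, Subtype.range_coe_subtype, ← Set.compl_singleton_eq,
      Set.compl_eq_univ_sdiff] at hcompl

end BeatPoints

/-! ### Geometric realizations -/

section Simplices

variable {V : Type u} {s t : Finset V}

theorem nonempty_of_mem {K : AbstractSimplicialComplex V} (hs : s ∈ K) : s.Nonempty :=
  (K.isRelLowerSet_faces hs).1

theorem mem_of_subset {K : AbstractSimplicialComplex V} (hs : s ∈ K) (hts : t ⊆ s)
    (ht : t.Nonempty) : t ∈ K :=
  (K.isRelLowerSet_faces hs).2 hts ht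

theorem nonempty_of_mem_pre {P : PreAbstractSimplicialComplex V} (hs : s ∈ P) : s.Nonempty :=
  (P.isRelLowerSet_faces hs).1

theorem mem_pre_of_subset {P : PreAbstractSimplicialComplex V} (hs : s ∈ P) (hts : t ⊆ s)
    (ht : t.Nonempty) : t ∈ P :=
  (P.isRelLowerSet_faces hs).2 hts ht

theorem preAbstractSimplicialComplex_ext {P Q : PreAbstractSimplicialComplex V}
    (h : ∀ s, s ∈ P ↔ s ∈ Q) : P = Q :=
  PreAbstractSimplicialComplex.ext (Set.ext h)

end Simplices

section SimplicialMap

variable {V W Z : Type u} {K : AbstractSimplicialComplex V} {L : AbstractSimplicialComplex W}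
  {M : AbstractSimplicialComplex Z}

/-- The identity simplicial map. -/
def SimplicialMap.id (K : AbstractSimplicialComplex V) : SimplicialMap K K where
  toFun v := v
  image_mem s hs := by simpa using hs

open Classical in
/-- Composition of simplicial maps. -/
def SimplicialMap.comp (ψ : SimplicialMap L M) (φ : SimplicialMap K L) : SimplicialMap K M where
  toFun v := ψ.toFun (φ.toFun v)
  image_mem s hs := by
    have himage := ψ.image_mem _ (φ.image_mem s hs)
    rwa [Finset.image_image] at himage

open Classical in
/-- Contiguous simplicial maps: they send each simplex into a common one. -/
def Contiguous (φ ψ : SimplicialMap K L) : Prop :=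
  ∀ s ∈ K, s.image φ.toFun ∪ s.image ψ.toFun ∈ L

end SimplicialMap

section Realization

variable {V W Z : Type u} [Fintype V] [Fintype W] [Fintype Z]
  {K : AbstractSimplicialComplex V} {L : AbstractSimplicialComplex W}
  {M : AbstractSimplicialComplex Z} {A : Type*} [TopologicalSpace A]

/-- The point `x` of `|K|` lies in the closed simplex spanned by `s`. -/
def Carried (x : Realization K) (s : Finset V) : Prop :=
  ∀ v, x.1 v ≠ 0 → v ∈ s

theorem Carried.mono {x : Realization K} {s t : Finset V} (h : Carried x s) (hst : s ⊆ t) :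
    Carried x t :=
  fun v hv => hst (h v hv)

theorem Carried.apply_eq_zero {x : Realization K} {s : Finset V} (h : Carried x s) {v : V}
    (hv : v ∉ s) : x.1 v = 0 :=
  not_imp_comm.1 (h v) hv

theorem exists_carried (x : Realization K) : ∃ s ∈ K, Carried x s := x.2

theorem realization_ext {x y : Realization K} (h : ∀ v, x.1 v = y.1 v) : x = y :=
  Subtype.ext (stdSimplex.ext (funext h))

theorem continuous_coord (v : V) : Continuous fun x : Realization K => x.1 v :=
  (continuous_apply v).comp (continuous_subtype_val.comp continuous_subtype_val)

/-- The map to a realization with given barycentric coordinates. -/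
def ofCoords (F : A → V → ℝ) (hcont : ∀ v, Continuous fun a => F a v) (hnonneg : ∀ a v, 0 ≤ F a v)
    (hsum : ∀ a, ∑ v, F a v = 1) (hsupp : ∀ a, ∃ s ∈ K, ∀ v, F a v ≠ 0 → v ∈ s) :
    C(A, Realization K) where
  toFun a := ⟨⟨F a, hnonneg a, hsum a⟩, hsupp a⟩
  continuous_toFun := ((continuous_pi hcont).subtype_mk _).subtype_mk _

/-- The straight-line homotopy stays in the common simplices. -/
theorem homotopic_of_carried {f g : C(A, Realization K)}
    (h : ∀ a, ∃ s ∈ K, Carried (f a) s ∧ Carried (g a) s) : f.Homotopic g := by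
  refine ⟨⟨ofCoords (fun (p : I × A) v => (1 - (p.1 : ℝ)) * (f p.2).1 v + p.1 * (g p.2).1 v)
    (fun v => ?_) (fun p v => ?_) (fun p => ?_) (fun p => ?_),
    fun a => realization_ext fun v => ?_, fun a => realization_ext fun v => ?_⟩⟩
  · have hf := (continuous_coord v).comp (f.continuous.comp (continuous_snd (X := I)))
    have hg := (continuous_coord v).comp (g.continuous.comp (continuous_snd (X := I)))
    have ht : Continuous fun p : I × A => (p.1 : ℝ) := by fun_prop
    exact ((continuous_const.sub ht).mul hf).add (ht.mul hg)
  · exact add_nonneg (mul_nonneg (sub_nonneg.2 p.1.2.2) (stdSimplex.zero_le _ v))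
      (mul_nonneg p.1.2.1 (stdSimplex.zero_le _ v))
  · rw [Finset.sum_add_distrib, ← Finset.mul_sum, ← Finset.mul_sum, stdSimplex.sum_eq_one,
      stdSimplex.sum_eq_one]
    ring
  · obtain ⟨s, hs, hf, hg⟩ := h p.2
    refine ⟨s, hs, fun v => not_imp_comm.1 fun hvs => ?_⟩
    rw [hf.apply_eq_zero hvs, hg.apply_eq_zero hvs, mul_zero, mul_zero, add_zero]
  · change (1 - ((0 : I) : ℝ)) * (f a).1 v + ((0 : I) : ℝ) * (g a).1 v = (f a).1 v
    simp
  · change (1 - ((1 : I) : ℝ)) * (f a).1 v + ((1 : I) : ℝ) * (g a).1 v = (g a).1 v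
    simp

open Classical in
theorem realization_apply (φ : SimplicialMap K L) (x : Realization K) (w : W) :
    (φ.realization x).1 w = ∑ v with φ.toFun v = w, x.1 v := by
  change (stdSimplex.map φ.toFun x.1) w = _
  rw [stdSimplex.map_coe, FunOnFinite.linearMap_apply_apply]

theorem realization_apply_of_injective {i : SimplicialMap K L} (hi : Function.Injective i.toFun)
    (x : Realization K) (v : V) : (i.realization x).1 (i.toFun v) = x.1 v := by
  classical
  rw [realization_apply, Finset.sum_eq_single_of_mem v (by simp)]
  exact fun u hu huv => absurd (hi (Finset.mem_filter.1 hu).2) huv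

theorem carried_realization (φ : SimplicialMap K L) {x : Realization K} {s : Finset V}
    {t : Finset W} (hx : Carried x s) (hst : ∀ v ∈ s, φ.toFun v ∈ t) :
    Carried (φ.realization x) t := by
  classical
  intro w hw
  rw [realization_apply] at hw
  obtain ⟨v, hv, hne⟩ := Finset.exists_ne_zero_of_sum_ne_zero hw
  rw [← (Finset.mem_filter.1 hv).2]
  exact hst v (hx v hne)

theorem realization_id : (SimplicialMap.id K).realization = ContinuousMap.id (Realization K) := by
  ext1 x
  exact Subtype.ext (stdSimplex.map_id_apply x.1)

theorem realization_comp (ψ : SimplicialMap L M) (φ : SimplicialMap K L) :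
    (ψ.comp φ).realization = ψ.realization.comp φ.realization := by
  ext1 x
  exact Subtype.ext (stdSimplex.map_comp_apply φ.toFun ψ.toFun x.1).symm

theorem Contiguous.homotopic {φ ψ : SimplicialMap K L} (h : Contiguous φ ψ) :
    φ.realization.Homotopic ψ.realization := by
  classical
  refine homotopic_of_carried fun x => ?_
  obtain ⟨s, hs, hx⟩ := exists_carried x
  exact ⟨_, h s hs,
    carried_realization φ hx fun v hv => Finset.mem_union_left _ (Finset.mem_image_of_mem _ hv),
    carried_realization ψ hx fun v hv => Finset.mem_union_right _ (Finset.mem_image_of_mem _ hv)⟩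

instance : CompactSpace (Realization K) := by
  suffices IsClosed {x : stdSimplex ℝ V | ∃ s ∈ K, ∀ v, x v ≠ 0 → v ∈ s} from
    isCompact_iff_compactSpace.1 this.isCompact
  have hunion : {x : stdSimplex ℝ V | ∃ s ∈ K, ∀ v, x v ≠ 0 → v ∈ s} =
      ⋃ s ∈ (K : Set (Finset V)), ⋂ v ∈ {v | v ∉ s}, {x : stdSimplex ℝ V | x v = 0} := by
    ext x
    simp only [Set.mem_ofPred_eq, Set.mem_iUnion, Set.mem_iInter, SetLike.mem_coe, exists_prop]
    exact exists_congr fun s => and_congr_right fun _ => forall_congr' fun v => not_imp_comm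
  rw [hunion]
  refine (Set.toFinite _).isClosed_biUnion fun s _ => isClosed_biInter fun v _ => ?_
  exact isClosed_eq ((continuous_apply v).comp continuous_subtype_val) continuous_const

/-- The part of `|K|` which is covered by the simplices of a subcomplex `P`. -/
def polyhedron (K : AbstractSimplicialComplex V) (P : PreAbstractSimplicialComplex V) :
    Set (Realization K) :=
  {x | ∃ s ∈ P, Carried x s}

theorem polyhedron_mono {P Q : PreAbstractSimplicialComplex V} (h : Q ≤ P) :
    polyhedron K Q ⊆ polyhedron K P :=
  fun _ ⟨s, hs, hx⟩ => ⟨s, h hs, hx⟩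

theorem exists_lift [DecidableEq W] {i : SimplicialMap K L} (hi : Function.Injective i.toFun)
    {f : C(A, Realization L)} (hf : ∀ a, ∃ s ∈ K, Carried (f a) (s.image i.toFun)) :
    ∃ g : C(A, Realization K), i.realization.comp g = f := by
  have hpull : ∀ (a) (s : Finset V), Carried (f a) (s.image i.toFun) →
      ∀ v, (f a).1 (i.toFun v) ≠ 0 → v ∈ s := fun a s hs v hv =>
    hi.mem_finset_image.1 (hs _ hv)
  have hrange : ∀ (s : Finset V) (w), w ∈ s.image i.toFun → w ∈ Set.range i.toFun := fun s w hw =>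
    let ⟨v, _, hv⟩ := Finset.mem_image.1 hw
    ⟨v, hv⟩
  refine ⟨ofCoords (fun a v => (f a).1 (i.toFun v))
    (fun v => (continuous_coord _).comp f.continuous) (fun a v => stdSimplex.zero_le _ _)
    (fun a => ?_) (fun a => ?_), ?_⟩
  · obtain ⟨s, -, hs⟩ := hf a
    rw [← stdSimplex.sum_eq_one (f a).1]
    refine Fintype.sum_of_injective i.toFun hi _ _
      (fun w hw => hs.apply_eq_zero fun hws => hw (hrange s w hws)) fun _ => rfl
  · obtain ⟨s, hsK, hs⟩ := hf a
    exact ⟨s, hsK, hpull a s hs⟩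
  · ext1 a
    obtain ⟨s, -, hs⟩ := hf a
    refine realization_ext fun w => ?_
    by_cases hw : w ∈ Set.range i.toFun
    · obtain ⟨v, rfl⟩ := hw
      exact realization_apply_of_injective hi _ v
    · have hws : w ∉ s.image i.toFun := fun hws => hw (hrange s w hws)
      refine Eq.trans (Carried.apply_eq_zero (s := s.image i.toFun) ?_ hws)
        (hs.apply_eq_zero hws).symm
      exact carried_realization i (hpull a s hs) fun v hv => Finset.mem_image_of_mem _ hv

end Realization

/-! ### Collapses -/

section Collapse

variable {V W : Type u}

/-- The subcomplex of the simplices of `P` which do not contain `S`. -/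
def deleteFace (P : PreAbstractSimplicialComplex V) (S : Finset V) :
    PreAbstractSimplicialComplex V where
  faces := {t | t ∈ P ∧ ¬ S ⊆ t}
  isRelLowerSet_faces := fun _ ht => ⟨nonempty_of_mem_pre ht.1, fun _ hb hne =>
    ⟨mem_pre_of_subset ht.1 hb hne, fun hS => ht.2 (hS.trans hb)⟩⟩

theorem deleteFace_le (P : PreAbstractSimplicialComplex V) (S : Finset V) : deleteFace P S ≤ P :=
  fun _ ht => ht.1

/-- `S` is a free face of `P`: the only simplices of `P` which contain `S` are `S` and `aS`. -/
structure IsFreeFace [DecidableEq V] (P : PreAbstractSimplicialComplex V) (S : Finset V) (a : V) :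
    Prop where
  notMem : a ∉ S
  mem_iff : ∀ t, t ∈ P ∧ S ⊆ t ↔ t = S ∨ t = insert a S

namespace IsFreeFace

variable [DecidableEq V] {P : PreAbstractSimplicialComplex V} {S : Finset V} {a : V}
  (h : IsFreeFace P S a)
include h

theorem mem : S ∈ P := ((h.mem_iff S).2 (.inl rfl)).1

theorem nonempty : S.Nonempty := nonempty_of_mem_pre h.mem

theorem insert_mem : insert a S ∈ P := ((h.mem_iff _).2 (.inr rfl)).1

theorem subset_insert {t : Finset V} (ht : t ∈ P) (hSt : S ⊆ t) : t ⊆ insert a S := by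
  rcases (h.mem_iff t).1 ⟨ht, hSt⟩ with rfl | rfl
  exacts [Finset.subset_insert _ _, subset_rfl]

end IsFreeFace

theorem elementaryCollapse_iff [inst : DecidableEq V] {P Q : PreAbstractSimplicialComplex V} :
    ElementaryCollapse P Q ↔ ∃ S a, IsFreeFace P S a ∧ Q = deleteFace P S := by
  obtain rfl : inst = fun a b => Classical.propDecidable (a = b) := Subsingleton.elim _ _
  classical
  constructor
  · rintro ⟨S, hS, a, -, haS, hP, hQ⟩
    have hSne := nonempty_of_mem_pre hS
    have hmem : ∀ t, t ∈ P ↔ t ∈ Q ∨ t.Nonempty ∧ t ⊆ insert a S := fun t => by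
      rw [hP]
      exact Iff.rfl
    have hinter : ∀ t, t ∈ Q ∧ t.Nonempty ∧ t ⊆ insert a S ↔
        t.Nonempty ∧ t ⊆ insert a S ∧ ¬ S ⊆ t := fun t => by
      change t ∈ Q ⊓ simplex (insert a S) ↔ t ∈ coneBoundary a S
      rw [hQ]
    have hQS : ∀ t ∈ Q, ¬ S ⊆ t := fun t ht hSt =>
      ((hinter S).1 ⟨mem_pre_of_subset ht hSt hSne, hSne, Finset.subset_insert _ _⟩).2.2
        subset_rfl
    refine ⟨S, a, ⟨haS, fun t => ⟨fun ⟨ht, hSt⟩ => ?_, ?_⟩⟩, preAbstractSimplicialComplex_ext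
      fun t => ⟨fun ht => ⟨(hmem t).2 (.inl ht), hQS t ht⟩, fun ⟨ht, hSt⟩ => ?_⟩⟩
    · have hta := (((hmem t).1 ht).resolve_left fun htQ => hQS t htQ hSt).2
      exact (Finset.covBy_insert haS).eq_or_eq hSt hta
    · rintro (rfl | rfl)
      · exact ⟨hS, subset_rfl⟩
      · exact ⟨(hmem _).2 (.inr ⟨Finset.insert_nonempty _ _, subset_rfl⟩),
          Finset.subset_insert _ _⟩
    · exact ((hmem t).1 ht).elim id fun hta => ((hinter t).2 ⟨hta.1, hta.2, hSt⟩).1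
  · rintro ⟨S, a, h, rfl⟩
    refine ⟨S, h.mem, a, mem_pre_of_subset h.insert_mem (by simp) (Finset.singleton_nonempty a),
      h.notMem, preAbstractSimplicialComplex_ext fun t => ⟨fun ht => ?_, ?_⟩,
      preAbstractSimplicialComplex_ext fun t => ⟨fun ht => ⟨ht.2.1, ht.2.2, ht.1.2⟩, fun ht =>
        ⟨⟨mem_pre_of_subset h.insert_mem ht.2.1 ht.1, ht.2.2⟩, ht.1, ht.2.1⟩⟩⟩
    · by_cases hSt : S ⊆ t
      · exact .inr ⟨nonempty_of_mem_pre ht, h.subset_insert ht hSt⟩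
      · exact .inl ⟨ht, hSt⟩
    · rintro (ht | ht)
      · exact ht.1
      · exact mem_pre_of_subset h.insert_mem ht.2 ht.1

theorem Collapses.le {P Q : PreAbstractSimplicialComplex V} (h : Collapses P Q) : Q ≤ P := by
  classical
  induction h with
  | refl => exact le_rfl
  | tail _ h ih =>
    obtain ⟨S, a, -, rfl⟩ := elementaryCollapse_iff.1 h
    exact (deleteFace_le _ S).trans ih

/-- If toggling the vertex `z` matches the simplices of `K` outside `L`, then a maximal simplex
outside `L` has a free face opposite to `z`, and deleting it preserves the matching. -/
theorem collapses_of_toggle [Finite V] [DecidableEq V] {K L : PreAbstractSimplicialComplex V}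
    (hLK : L ≤ K) (z : V)
    (h : ∀ s ∈ K, s ∉ L → insert z s ∈ K ∧ s.erase z ∈ K ∧ s.erase z ∉ L) : Collapses K L := by
  induction hn : {s | s ∈ K ∧ s ∉ L}.ncard using Nat.strong_induction_on generalizing K with
  | _ n ih =>
    by_cases hKL : K ≤ L
    · rw [hKL.antisymm hLK]
      exact .refl
    obtain ⟨s, ⟨hsK, hsL⟩, hmax⟩ := Set.exists_max_image {s | s ∈ K ∧ s ∉ L} Finset.card
      (Set.toFinite _) (Set.not_subset.1 hKL)
    obtain ⟨-, hSK, hSL⟩ := h s hsK hsL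
    have hup : ∀ t, s.erase z ⊆ t → t ∉ L := fun t hSt ht =>
      hSL (mem_pre_of_subset ht hSt (nonempty_of_mem_pre hSK))
    have hins : ∀ t ∈ K, s.erase z ⊆ t → insert z t = s := fun t ht hSt => by
      have htz := h t ht (hup t hSt)
      have hst : s ⊆ insert z t := Finset.subset_insert_iff.2 hSt
      exact (Finset.eq_of_subset_of_card_le hst
        (hmax _ ⟨htz.1, hup _ (hSt.trans (Finset.subset_insert z t))⟩)).symm
    have hfree : IsFreeFace K (s.erase z) z := by
      refine ⟨Finset.notMem_erase z s, fun t => ⟨fun ⟨ht, hSt⟩ => ?_, ?_⟩⟩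
      · refine (Finset.covBy_insert (Finset.notMem_erase z s)).eq_or_eq hSt ?_
        rw [hins _ hSK subset_rfl, ← hins t ht hSt]
        exact Finset.subset_insert z t
      · rintro (rfl | rfl)
        · exact ⟨hSK, subset_rfl⟩
        · rw [hins _ hSK subset_rfl]
          exact ⟨hsK, Finset.erase_subset z s⟩
    refine .head (elementaryCollapse_iff.2 ⟨_, z, hfree, rfl⟩)
      (ih _ ?_ (fun t ht => ⟨hLK ht, fun hSt => hup t hSt ht⟩) (fun t ht htL => ?_) rfl)
    · rw [← hn]
      exact Set.ncard_lt_ncard ⟨fun t ht => ⟨ht.1.1, ht.2⟩, fun hsub =>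
        (hsub (show s ∈ {s | s ∈ K ∧ s ∉ L} from ⟨hsK, hsL⟩)).1.2 (Finset.erase_subset z s)⟩
    · obtain ⟨hinsert, herase, heraseL⟩ := h t ht.1 htL
      refine ⟨⟨hinsert, fun hSt => ht.2 ?_⟩,
        ⟨herase, fun hSt => ht.2 (hSt.trans (Finset.erase_subset z t))⟩, heraseL⟩
      rwa [Finset.subset_insert_iff_of_notMem (Finset.notMem_erase z s)] at hSt

theorem collapses_of_forall_exists_removable {ι : Type*} [Finite ι]
    (F : Set ι → PreAbstractSimplicialComplex V)
    (h : ∀ T : Set ι, T.Nonempty → ∃ x ∈ T, Collapses (F T) (F (T \ {x}))) (T : Set ι) :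
    Collapses (F T) (F ∅) := by
  induction T using WellFoundedLT.induction with
  | _ T ih =>
    rcases T.eq_empty_or_nonempty with rfl | hT
    · exact .refl
    · obtain ⟨x, hx, hcollapse⟩ := h T hT
      exact hcollapse.trans (ih _ (Set.sdiff_singleton_ssubset.2 hx))

theorem isExpansion_of_collapses {L : AbstractSimplicialComplex V}
    {K : AbstractSimplicialComplex W} [inst : DecidableEq W] {i : SimplicialMap L K}
    (hi : Function.Injective i.toFun) (hreflect : ∀ s, s.image i.toFun ∈ K → s ∈ L)
    {Q : PreAbstractSimplicialComplex W}
    (hQ : ∀ t, t ∈ Q ↔ t ∈ K ∧ ∀ w ∈ t, w ∈ Set.range i.toFun)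
    (h : Collapses K.toPreAbstractSimplicialComplex Q) : IsExpansion i := by
  obtain rfl : inst = fun a b => Classical.propDecidable (a = b) := Subsingleton.elim _ _
  classical
  have hmap : L.toPreAbstractSimplicialComplex.map i.toFun = Q := by
    refine preAbstractSimplicialComplex_ext fun t => Iff.trans ⟨?_, fun ⟨htK, ht⟩ => ?_⟩ (hQ t).symm
    · rintro ⟨s, hs, rfl⟩
      refine ⟨i.image_mem s hs, fun w hw => ?_⟩
      obtain ⟨v, -, hv⟩ := Finset.mem_image.1 hw
      exact ⟨v, hv⟩
    · obtain ⟨s, -, rfl⟩ := Finset.subset_set_image_iff.1 (by rwa [Set.image_univ])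
      exact ⟨s, hreflect s htK, rfl⟩
  exact ⟨hi, hmap ▸ h⟩

end Collapse

section Push

variable {V : Type u} [DecidableEq V] {S : Finset V} {a : V}

/-- Linear push of the simplex `aS` away from its face `S` onto the cone `a ∂S`: the largest
possible common amount is moved from the coordinates in `S` to the coordinate `a`. -/
noncomputable def pushCoord (S : Finset V) (hS : S.Nonempty) (a : V) (x : V → ℝ) (v : V) : ℝ :=
  x v + S.inf' hS x * ((if v = a then (S.card : ℝ) else 0) - if v ∈ S then 1 else 0)

theorem continuous_pushCoord (hS : S.Nonempty) (v : V) :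
    Continuous fun x => pushCoord S hS a x v :=
  (continuous_apply v).add
    ((Continuous.finset_inf'_apply hS fun w _ => continuous_apply w).mul continuous_const)

theorem pushCoord_of_notMem (hS : S.Nonempty) (x : V → ℝ) {v : V} (hv : v ∉ insert a S) :
    pushCoord S hS a x v = x v := by
  rw [Finset.mem_insert, not_or] at hv
  simp [pushCoord, hv.1, hv.2]

theorem pushCoord_of_mem (hS : S.Nonempty) (ha : a ∉ S) (x : V → ℝ) {v : V} (hv : v ∈ S) :
    pushCoord S hS a x v = x v - S.inf' hS x := by
  simp [pushCoord, hv, ne_of_mem_of_not_mem hv ha, sub_eq_add_neg]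

theorem pushCoord_nonneg (hS : S.Nonempty) (ha : a ∉ S) {x : V → ℝ} (hx : ∀ v, 0 ≤ x v) (v : V) :
    0 ≤ pushCoord S hS a x v := by
  by_cases hv : v ∈ S
  · rw [pushCoord_of_mem hS ha x hv]
    exact sub_nonneg.2 (Finset.inf'_le x hv)
  · have hmin : 0 ≤ S.inf' hS x := Finset.le_inf' _ _ fun w _ => hx w
    have hxv := hx v
    simp only [pushCoord, hv, if_false, sub_zero]
    positivity

theorem sum_pushCoord [Fintype V] (hS : S.Nonempty) (x : V → ℝ) :
    ∑ v, pushCoord S hS a x v = ∑ v, x v := by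
  simp [pushCoord, Finset.sum_add_distrib, ← Finset.mul_sum]

theorem pushCoord_eq_self (hS : S.Nonempty) {x : V → ℝ} (hx : ∀ v, 0 ≤ x v) {w : V} (hw : w ∈ S)
    (hxw : x w = 0) : pushCoord S hS a x = x := by
  have hmin : S.inf' hS x = 0 :=
    le_antisymm (hxw ▸ Finset.inf'_le x hw) (Finset.le_inf' _ _ fun v _ => hx v)
  ext v
  simp [pushCoord, hmin]

theorem exists_pushCoord_eq_zero (hS : S.Nonempty) (ha : a ∉ S) (x : V → ℝ) :
    ∃ v ∈ S, pushCoord S hS a x v = 0 := by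
  obtain ⟨v, hv, hmin⟩ := Finset.exists_mem_eq_inf' hS x
  exact ⟨v, hv, by rw [pushCoord_of_mem hS ha x hv, hmin, sub_self]⟩

variable [Fintype V] {K : AbstractSimplicialComplex V} {P : PreAbstractSimplicialComplex V}

theorem IsFreeFace.exists_support_pushCoord (h : IsFreeFace P S a) {x : Realization K}
    (hx : x ∈ polyhedron K P) : ∃ s ∈ deleteFace P S,
      (∀ v, pushCoord S h.nonempty a x.1 v ≠ 0 → v ∈ s) ∧ ∃ t ∈ P, Carried x t ∧ s ⊆ t := by
  obtain ⟨t, ht, hxt⟩ := hx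
  by_cases hSt : S ⊆ t
  · let s : Finset V := {v ∈ insert a S | pushCoord S h.nonempty a x.1 v ≠ 0}
    have hxa := hxt.mono (h.subset_insert ht hSt)
    have hs : ∀ v, pushCoord S h.nonempty a x.1 v ≠ 0 → v ∈ s := fun v hv => by
      refine Finset.mem_filter.2 ⟨by_contra fun hva => hv ?_, hv⟩
      rw [pushCoord_of_notMem h.nonempty _ hva, hxa.apply_eq_zero hva]
    have hsum : ∑ v, pushCoord S h.nonempty a x.1 v ≠ 0 := by
      simp [sum_pushCoord]
    obtain ⟨v, -, hv⟩ := Finset.exists_ne_zero_of_sum_ne_zero hsum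
    obtain ⟨w, hw, hw0⟩ := exists_pushCoord_eq_zero h.nonempty h.notMem x.1
    have hsa : s ⊆ insert a S := Finset.filter_subset _ _
    exact ⟨s, ⟨mem_pre_of_subset h.insert_mem hsa ⟨v, hs v hv⟩,
      fun hSs => (Finset.mem_filter.1 (hSs hw)).2 hw0⟩, hs, _, h.insert_mem, hxa, hsa⟩
  · obtain ⟨w, hw, hwt⟩ := Finset.not_subset.1 hSt
    refine ⟨t, ⟨ht, hSt⟩, fun v hv => hxt v ?_, t, ht, hxt, subset_rfl⟩
    rwa [pushCoord_eq_self h.nonempty (stdSimplex.zero_le x.1) hw (hxt.apply_eq_zero hwt)] at hv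

theorem IsFreeFace.exists_homotopic_push (h : IsFreeFace P S a)
    (hPK : P ≤ K.toPreAbstractSimplicialComplex) {A : Type*} [TopologicalSpace A]
    {f : C(A, Realization K)} (hf : ∀ y, f y ∈ polyhedron K P) :
    ∃ g : C(A, Realization K), g.Homotopic f ∧ (∀ y, g y ∈ polyhedron K (deleteFace P S)) ∧
      ∀ y, f y ∈ polyhedron K (deleteFace P S) → g y = f y := by
  have hcont : Continuous fun y => ((f y).1 : V → ℝ) :=
    continuous_subtype_val.comp (continuous_subtype_val.comp f.continuous)
  let g : C(A, Realization K) := ofCoords (fun y => pushCoord S h.nonempty a (f y).1)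
    (fun v => (continuous_pushCoord h.nonempty v).comp hcont)
    (fun y => pushCoord_nonneg h.nonempty h.notMem (stdSimplex.zero_le (f y).1))
    (fun y => (sum_pushCoord h.nonempty _).trans (stdSimplex.sum_eq_one (f y).1))
    (fun y => by
      obtain ⟨s, hs, hsupp, -⟩ := h.exists_support_pushCoord (hf y)
      exact ⟨s, hPK hs.1, hsupp⟩)
  refine ⟨g, homotopic_of_carried fun y => ?_, fun y => ?_, fun y ⟨t, ht, hyt⟩ => ?_⟩
  · obtain ⟨s, -, hsupp, t, ht, hyt, hst⟩ := h.exists_support_pushCoord (hf y)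
    exact ⟨t, hPK ht, fun v hv => hst (hsupp v hv), hyt⟩
  · obtain ⟨s, hs, hsupp, -⟩ := h.exists_support_pushCoord (hf y)
    exact ⟨s, hs, hsupp⟩
  · obtain ⟨w, hw, hwt⟩ := Finset.not_subset.1 ht.2
    exact realization_ext (congrFun (pushCoord_eq_self h.nonempty (stdSimplex.zero_le (f y).1) hw
      (hyt.apply_eq_zero hwt)))

end Push

/-! ### Simple homotopy equivalences -/

section SimpleHomotopyEquiv

open ContinuousMap (HomotopyEquiv)

variable {V W Z : Type u} [Fintype V] [Fintype W] [Fintype Z]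
  {K : AbstractSimplicialComplex V} {L : AbstractSimplicialComplex W}
  {M : AbstractSimplicialComplex Z}

theorem exists_retraction_of_collapses {Q : PreAbstractSimplicialComplex V}
    (h : Collapses K.toPreAbstractSimplicialComplex Q) :
    ∃ r : C(Realization K, Realization K), r.Homotopic (ContinuousMap.id _) ∧
      (∀ x, r x ∈ polyhedron K Q) ∧ ∀ x ∈ polyhedron K Q, r x = x := by
  classical
  induction h with
  | refl => exact ⟨ContinuousMap.id _, .refl _, exists_carried, fun _ _ => rfl⟩
  | tail hKP hPQ ih =>
    obtain ⟨r, hr, hrP, hrfix⟩ := ih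
    obtain ⟨S, a, hfree, rfl⟩ := elementaryCollapse_iff.1 hPQ
    obtain ⟨g, hg, hgQ, hgfix⟩ := hfree.exists_homotopic_push (Collapses.le hKP) hrP
    refine ⟨g, hg.trans hr, hgQ, fun x hx => ?_⟩
    have hrx := hrfix x (polyhedron_mono (deleteFace_le _ S) hx)
    rw [hgfix x (by rwa [hrx]), hrx]

theorem IsExpansion.exists_retraction {i : SimplicialMap L K} (hi : IsExpansion i) :
    ∃ r : C(Realization K, Realization L), r.comp i.realization = ContinuousMap.id _ ∧
      (i.realization.comp r).Homotopic (ContinuousMap.id _) := by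
  classical
  obtain ⟨ρ, hρ, hρL, hρfix⟩ := exists_retraction_of_collapses hi.2
  obtain ⟨r, hr⟩ := exists_lift hi.1 (f := ρ) fun x => by
    obtain ⟨_, ⟨s, hs, rfl⟩, hx⟩ := hρL x
    exact ⟨s, hs, hx⟩
  refine ⟨r, ContinuousMap.ext fun y => realization_ext fun v => ?_, hr ▸ hρ⟩
  obtain ⟨s, hs, hy⟩ := exists_carried y
  have hfix := hρfix (i.realization y) ⟨_, ⟨s, hs, rfl⟩,
    carried_realization i hy fun v hv => Finset.mem_image_of_mem _ hv⟩
  rw [← hr] at hfix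
  change i.realization (r (i.realization y)) = i.realization y at hfix
  change (r (i.realization y)).1 v = y.1 v
  rw [← realization_apply_of_injective hi.1, hfix, realization_apply_of_injective hi.1]

theorem IsExpansion.exists_homotopyEquiv {i : SimplicialMap L K} (hi : IsExpansion i) :
    ∃ e : HomotopyEquiv (Realization L) (Realization K), e.toFun = i.realization := by
  obtain ⟨r, hri, hir⟩ := hi.exists_retraction
  exact ⟨⟨i.realization, r, hri ▸ .refl _, hir⟩, rfl⟩

theorem IsDeformation.comp {f : C(Realization K, Realization L)}
    {g : C(Realization L, Realization M)} (hf : IsDeformation f) (hg : IsDeformation g) :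
    IsDeformation (g.comp f) := by
  induction hg with
  | refl => exact hf
  | expansion i hi _ ih =>
    rw [ContinuousMap.comp_assoc]
    exact .expansion i hi (ih hf)
  | inverse i r hi hri hir _ ih =>
    rw [ContinuousMap.comp_assoc]
    exact .inverse i r hi hri hir (ih hf)

theorem IsExpansion.isDeformation {i : SimplicialMap K L} (hi : IsExpansion i) :
    IsDeformation i.realization := by
  simpa only [ContinuousMap.comp_id] using IsDeformation.expansion i hi (.refl K)

theorem IsDeformation.exists_homotopyEquiv {f : C(Realization K, Realization L)}
    (hf : IsDeformation f) :
    ∃ e : HomotopyEquiv (Realization K) (Realization L), e.toFun = f ∧ IsDeformation e.invFun := by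
  induction hf with
  | refl K => exact ⟨.refl _, rfl, .refl K⟩
  | expansion i hi _ ih =>
    obtain ⟨e, rfl, hinv⟩ := ih
    obtain ⟨d, hd⟩ := hi.exists_homotopyEquiv
    have hdinv : IsDeformation d.invFun := by
      simpa only [ContinuousMap.comp_id] using
        IsDeformation.inverse i d.invFun hi (hd ▸ d.left_inv) (hd ▸ d.right_inv) (.refl _)
    exact ⟨e.trans d, hd ▸ rfl, hdinv.comp hinv⟩
  | inverse i r hi hri hir _ ih =>
    obtain ⟨e, rfl, hinv⟩ := ih
    exact ⟨e.trans ⟨r, i.realization, hir, hri⟩, rfl, hi.isDeformation.comp hinv⟩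

theorem isSimpleHomotopyEquiv_iff {f : C(Realization K, Realization L)} :
    IsSimpleHomotopyEquiv f ↔ ∃ g, IsDeformation g ∧ f.Homotopic g := by
  refine ⟨fun h => h.2, fun ⟨g, hg, hfg⟩ => ⟨?_, g, hg, hfg⟩⟩
  obtain ⟨e, rfl, -⟩ := hg.exists_homotopyEquiv
  exact ⟨⟨f, e.invFun, (ContinuousMap.Homotopic.comp (.refl _) hfg).trans e.left_inv,
    (ContinuousMap.Homotopic.comp hfg (.refl _)).trans e.right_inv⟩, rfl⟩

theorem IsDeformation.isSimpleHomotopyEquiv {f : C(Realization K, Realization L)}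
    (hf : IsDeformation f) : IsSimpleHomotopyEquiv f :=
  isSimpleHomotopyEquiv_iff.2 ⟨f, hf, .refl f⟩

namespace IsSimpleHomotopyEquiv

theorem congr {f g : C(Realization K, Realization L)} (h : f.Homotopic g)
    (hf : IsSimpleHomotopyEquiv f) : IsSimpleHomotopyEquiv g := by
  obtain ⟨d, hd, hfd⟩ := isSimpleHomotopyEquiv_iff.1 hf
  exact isSimpleHomotopyEquiv_iff.2 ⟨d, hd, h.symm.trans hfd⟩

theorem comp {f : C(Realization L, Realization M)} {g : C(Realization K, Realization L)}
    (hf : IsSimpleHomotopyEquiv f) (hg : IsSimpleHomotopyEquiv g) :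
    IsSimpleHomotopyEquiv (f.comp g) := by
  obtain ⟨d, hd, hfd⟩ := isSimpleHomotopyEquiv_iff.1 hf
  obtain ⟨e, he, hge⟩ := isSimpleHomotopyEquiv_iff.1 hg
  exact isSimpleHomotopyEquiv_iff.2 ⟨d.comp e, he.comp hd, hfd.comp hge⟩

theorem exists_inverse {f : C(Realization K, Realization L)} (hf : IsSimpleHomotopyEquiv f) :
    ∃ g : C(Realization L, Realization K), IsSimpleHomotopyEquiv g ∧
      (g.comp f).Homotopic (.id _) ∧ (f.comp g).Homotopic (.id _) := by
  obtain ⟨d, hd, hfd⟩ := isSimpleHomotopyEquiv_iff.1 hf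
  obtain ⟨e, rfl, hinv⟩ := hd.exists_homotopyEquiv
  exact ⟨e.invFun, hinv.isSimpleHomotopyEquiv,
    (ContinuousMap.Homotopic.comp (.refl _) hfd).trans e.left_inv,
    (ContinuousMap.Homotopic.comp hfd (.refl _)).trans e.right_inv⟩

theorem of_comp_left {f : C(Realization L, Realization M)} {g : C(Realization K, Realization L)}
    (hg : IsSimpleHomotopyEquiv g) (h : IsSimpleHomotopyEquiv (f.comp g)) :
    IsSimpleHomotopyEquiv f := by
  obtain ⟨g', hg', -, hgg'⟩ := hg.exists_inverse
  exact (h.comp hg').congr (ContinuousMap.Homotopic.comp (.refl f) hgg')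

theorem of_comp_right {f : C(Realization L, Realization M)} {g : C(Realization K, Realization L)}
    (hf : IsSimpleHomotopyEquiv f) (h : IsSimpleHomotopyEquiv (f.comp g)) :
    IsSimpleHomotopyEquiv g := by
  obtain ⟨f', hf', hf'f, -⟩ := hf.exists_inverse
  exact (hf'.comp h).congr (ContinuousMap.Homotopic.comp hf'f (.refl g))

theorem cancel_left {f : C(Realization L, Realization M)} {A : Type*} [TopologicalSpace A]
    {g h : C(A, Realization L)} (hf : IsSimpleHomotopyEquiv f)
    (hgh : (f.comp g).Homotopic (f.comp h)) : g.Homotopic h := by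
  obtain ⟨f', -, hf'f, -⟩ := hf.exists_inverse
  have hg := ContinuousMap.Homotopic.comp hf'f (.refl g)
  have hh := ContinuousMap.Homotopic.comp hf'f (.refl h)
  exact hg.symm.trans ((ContinuousMap.Homotopic.comp (.refl f') hgh).trans hh)

end IsSimpleHomotopyEquiv

theorem isSimpleHomotopyEquiv_of_cylinder {C : Type u} [Finite C]
    {M : AbstractSimplicialComplex C} {φ : SimplicialMap K L}
    {i : SimplicialMap K M} {j : SimplicialMap L M} (ρ : SimplicialMap M L)
    (hi : IsExpansion i) (hj : IsExpansion j) (hρi : ρ.comp i = φ) (hρj : ρ.comp j = .id L) :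
    IsSimpleHomotopyEquiv φ.realization := by
  have := Fintype.ofFinite C
  have hρ : IsSimpleHomotopyEquiv ρ.realization := by
    refine .of_comp_left hj.isDeformation.isSimpleHomotopyEquiv ?_
    rw [← realization_comp, hρj, realization_id]
    exact (IsDeformation.refl L).isSimpleHomotopyEquiv
  rw [← hρi, realization_comp]
  exact hρ.comp hi.isDeformation.isSimpleHomotopyEquiv

end SimpleHomotopyEquiv

/-! ### Clique complexes -/

section Clique

variable {V : Type u}

/-- The complex of finite cliques of the relation `r` in the set `A`. -/
def cliqueComplex (r : V → V → Prop) (A : Set V) : PreAbstractSimplicialComplex V where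
  faces := {t | t.Nonempty ∧ (∀ v ∈ t, v ∈ A) ∧ ∀ v ∈ t, ∀ w ∈ t, r v w}
  isRelLowerSet_faces := fun _ ht => ⟨ht.1, fun _ hb hne =>
    ⟨hne, fun v hv => ht.2.1 v (hb hv), fun v hv w hw => ht.2.2 v (hb hv) w (hb hw)⟩⟩

/-- Among the cliques of `r` in `A`, the link of the vertex `x` is the join of the complex of
cliques in `D` and the complex of those cliques of the link which avoid `D`. -/
structure LinkIsJoin (r : V → V → Prop) (A D : Set V) (x : V) : Prop where
  subset : D ⊆ A
  notMem : x ∉ D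
  adj : ∀ d ∈ D, r x d
  neighbor : ∀ w ∈ A, r x w → w = x ∨ w ∈ D ∨ ∀ d ∈ D, r w d

/-- The cliques of `r` in `A` which, if they contain `x`, meet `D` in a subset of `D'` only. These
interpolate between all cliques, where `D' = D`, and the cliques avoiding `x`. -/
def restrictedCliqueComplex (r : V → V → Prop) (A D : Set V) (x : V) (D' : Set V) :
    PreAbstractSimplicialComplex V where
  faces := {t | t ∈ cliqueComplex r A ∧ (x ∈ t → ∀ w ∈ t, w ∈ D → w ∈ D')}
  isRelLowerSet_faces := fun _ ht => ⟨nonempty_of_mem_pre ht.1, fun _ hb hne =>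
    ⟨mem_pre_of_subset ht.1 hb hne, fun hx w hw => ht.2 (hb hx) w (hb hw)⟩⟩

theorem mem_cliqueComplex_iff_univ {r : V → V → Prop} {A : Set V} {t : Finset V} :
    t ∈ cliqueComplex r A ↔ t ∈ cliqueComplex r Set.univ ∧ ∀ v ∈ t, v ∈ A :=
  ⟨fun ht => ⟨⟨ht.1, fun _ _ => Set.mem_univ _, ht.2.2⟩, ht.2.1⟩,
    fun ht => ⟨ht.1.1, ht.2, ht.1.2.2⟩⟩

theorem restrictedCliqueComplex_self (r : V → V → Prop) (A D : Set V) (x : V) :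
    restrictedCliqueComplex r A D x D = cliqueComplex r A :=
  preAbstractSimplicialComplex_ext fun _ => ⟨fun ht => ht.1, fun ht => ⟨ht, fun _ _ _ hw => hw⟩⟩

theorem mem_cliqueComplex_diff_iff {r : V → V → Prop} {A : Set V} {x : V} {t : Finset V} :
    t ∈ cliqueComplex r (A \ {x}) ↔ t ∈ cliqueComplex r A ∧ x ∉ t :=
  ⟨fun ht => ⟨⟨ht.1, fun v hv => (ht.2.1 v hv).1, ht.2.2⟩, fun hx => (ht.2.1 x hx).2 rfl⟩,
    fun ht => ⟨ht.1.1, fun v hv => ⟨ht.1.2.1 v hv, fun hvx => ht.2 (hvx ▸ hv)⟩, ht.1.2.2⟩⟩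

theorem insert_mem_cliqueComplex [DecidableEq V] {r : V → V → Prop} (hrefl : ∀ v, r v v)
    (hsymm : ∀ v w, r v w → r w v) {A : Set V} {t : Finset V} {z : V}
    (ht : t ∈ cliqueComplex r A) (hz : z ∈ A) (htz : ∀ w ∈ t, r w z) :
    insert z t ∈ cliqueComplex r A := by
  refine ⟨Finset.insert_nonempty z t, Finset.forall_mem_insert .. |>.2 ⟨hz, ht.2.1⟩, ?_⟩
  simp only [Finset.forall_mem_insert]
  exact ⟨⟨hrefl z, fun w hw => hsymm w z (htz w hw)⟩, fun v hv => ⟨htz v hv, ht.2.2 v hv⟩⟩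

namespace LinkIsJoin

variable {r : V → V → Prop} (hrefl : ∀ v, r v v) (hsymm : ∀ v w, r v w → r w v)
  {A D D' : Set V} {x z : V} (h : LinkIsJoin r A D x)
include hrefl hsymm h

theorem insert_mem [DecidableEq V] (hz : z ∈ D') (hzD : z ∈ D) {t : Finset V}
    (ht : t ∈ restrictedCliqueComplex r A D x D') (hx : x ∈ t)
    (htz : ∀ w ∈ t, w ∈ D' → r w z) : insert z t ∈ restrictedCliqueComplex r A D x D' := by
  refine ⟨insert_mem_cliqueComplex hrefl hsymm ht.1 (h.subset hzD) fun w hw => ?_, fun _ => ?_⟩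
  · rcases h.neighbor w (ht.1.2.1 w hw) (ht.1.2.2 x hx w hw) with rfl | hwD | hwD
    · exact h.adj z hzD
    · exact htz w hw (ht.2 hx w hw hwD)
    · exact hwD z hzD
  · exact Finset.forall_mem_insert .. |>.2 ⟨fun _ => hz, ht.2 hx⟩

theorem collapses_of_dominated [Finite V] [DecidableEq V] (hz : z ∈ D') (hzD : z ∈ D)
    {Q : PreAbstractSimplicialComplex V} (hQ : Q ≤ restrictedCliqueComplex r A D x D')
    (hdom : ∀ t ∈ restrictedCliqueComplex r A D x D', t ∉ Q →
      x ∈ t ∧ t.erase z ∉ Q ∧ ∀ w ∈ t, w ∈ D' → r w z) :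
    Collapses (restrictedCliqueComplex r A D x D') Q := by
  refine collapses_of_toggle hQ z fun t ht htQ => ?_
  obtain ⟨hx, herase, htz⟩ := hdom t ht htQ
  have hxz : x ≠ z := fun hxz => h.notMem (hxz ▸ hzD)
  exact ⟨h.insert_mem hrefl hsymm hz hzD ht hx htz,
    mem_pre_of_subset ht (Finset.erase_subset z t) ⟨x, Finset.mem_erase.2 ⟨hxz, hx⟩⟩, herase⟩

theorem collapses_restricted_singleton [Finite V] (hzD : z ∈ D) :
    Collapses (restrictedCliqueComplex r A D x {z}) (cliqueComplex r (A \ {x})) := by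
  classical
  have hxz : x ≠ z := fun hxz => h.notMem (hxz ▸ hzD)
  have hle : cliqueComplex r (A \ {x}) ≤ restrictedCliqueComplex r A D x {z} := fun t ht => by
    obtain ⟨htA, hxt⟩ := mem_cliqueComplex_diff_iff.1 ht
    exact ⟨htA, fun hx => absurd hx hxt⟩
  refine h.collapses_of_dominated hrefl hsymm (Set.mem_singleton z) hzD hle fun t ht htQ => ?_
  rw [mem_cliqueComplex_diff_iff, not_and_not_right] at htQ
  refine ⟨htQ ht.1, fun herase => ?_, fun w _ hwz => hwz ▸ hrefl w⟩
  exact (mem_cliqueComplex_diff_iff.1 herase).2 (Finset.mem_erase.2 ⟨hxz, htQ ht.1⟩)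

theorem collapses_restricted_diff [Finite V] {y : V} (hyD : y ∈ D) (hz : z ∈ D') (hzD : z ∈ D)
    (hzy : z ≠ y) (hdom : ∀ w ∈ D', r w y → r w z) :
    Collapses (restrictedCliqueComplex r A D x D')
      (restrictedCliqueComplex r A D x (D' \ {y})) := by
  classical
  have hxz : x ≠ z := fun hxz => h.notMem (hxz ▸ hzD)
  refine h.collapses_of_dominated hrefl hsymm hz hzD
    (fun t ht => ⟨ht.1, fun hx w hw hwD => (ht.2 hx w hw hwD).1⟩) fun t ht htQ => ?_
  have hxy : x ∈ t ∧ y ∈ t := by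
    by_contra hxy
    exact htQ ⟨ht.1, fun hx w hw hwD => ⟨ht.2 hx w hw hwD, fun hwy => hxy ⟨hx, hwy ▸ hw⟩⟩⟩
  refine ⟨hxy.1, fun herase => ?_, fun w hw hwD' => hdom w hwD' (ht.1.2.2 w hw y hxy.2)⟩
  exact (herase.2 (Finset.mem_erase.2 ⟨hxz, hxy.1⟩) y
    (Finset.mem_erase.2 ⟨hzy.symm, hxy.2⟩) hyD).2 rfl

theorem collapses [Finite V] (hD : Dismantlable r D) :
    Collapses (cliqueComplex r A) (cliqueComplex r (A \ {x})) := by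
  suffices ∀ D', Dismantlable r D' → D' ⊆ D →
      Collapses (restrictedCliqueComplex r A D x D') (cliqueComplex r (A \ {x})) by
    simpa only [restrictedCliqueComplex_self] using this D hD subset_rfl
  intro D' hD'
  induction hD' with
  | single p => exact fun hp => h.collapses_restricted_singleton hrefl hsymm (hp rfl)
  | step hy hz hzy hdom _ ih =>
    exact fun hDD => (h.collapses_restricted_diff hrefl hsymm (hDD hy) hz (hDD hz) hzy hdom).trans
      (ih (Set.sdiff_subset.trans hDD))

end LinkIsJoin

theorem collapses_cliqueComplex_of_linkIsJoin [Finite V] {r : V → V → Prop}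
    (hrefl : ∀ v, r v v) (hsymm : ∀ v w, r v w → r w v) {ι : Type*} [Finite ι] {e : ι → V}
    (he : Function.Injective e) {A : Set V} (hA : ∀ j, e j ∉ A)
    (h : ∀ T : Set ι, T.Nonempty →
      ∃ j ∈ T, ∃ D, Dismantlable r D ∧ LinkIsJoin r (A ∪ e '' T) D (e j)) :
    Collapses (cliqueComplex r (A ∪ Set.range e)) (cliqueComplex r A) := by
  have hF := collapses_of_forall_exists_removable (fun T => cliqueComplex r (A ∪ e '' T))
    (fun T hT => ?_) Set.univ
  · simpa only [Set.image_univ, Set.image_empty, Set.union_empty] using hF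
  · obtain ⟨j, hj, D, hD, hlink⟩ := h T hT
    have hremove : (A ∪ e '' T) \ {e j} = A ∪ e '' (T \ {j}) := by
      rw [Set.union_sdiff_distrib, Set.sdiff_singleton_eq_self (hA j), Set.image_sdiff he,
        Set.image_singleton]
    exact ⟨j, hj, hremove ▸ hlink.collapses hrefl hsymm hD⟩

end Clique

/-! ### Mapping cylinders -/

section Cylinder

variable {X Y : Type u} [TopologicalSpace X] [TopologicalSpace Y]

theorem mem_orderComplex_iff {s : Finset X} :
    s ∈ orderComplex X ↔ s.Nonempty ∧ ∀ a ∈ s, ∀ b ∈ s, Comparable a b := by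
  refine and_congr Iff.rfl ⟨fun h a ha b hb => ?_, fun h a ha b hb _ => ?_⟩
  · rcases eq_or_ne a b with rfl | hab
    · exact .inl specializes_rfl
    · exact (h ha hb hab).imp mem_minOpen_iff.1 mem_minOpen_iff.1
  · exact (h a ha b hb).imp mem_minOpen_iff.2 mem_minOpen_iff.2

/-- The order of the mapping cylinder of `f`: the points of `Y` above `f x` are put above `x`. -/
def cylLE (f : X → Y) : X ⊕ Y → X ⊕ Y → Prop
  | .inl x, .inl x' => x ⤳ x'
  | .inl x, .inr y => f x ⤳ y
  | .inr _, .inl _ => False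
  | .inr y, .inr y' => y ⤳ y'

/-- Comparability in the mapping cylinder. -/
def cylComparable (f : X → Y) (a b : X ⊕ Y) : Prop := cylLE f a b ∨ cylLE f b a

theorem cylComparable_refl (f : X → Y) (a : X ⊕ Y) : cylComparable f a a := by
  rcases a with a | a <;> exact .inl specializes_rfl

theorem cylComparable_symm (f : X → Y) (a b : X ⊕ Y) (h : cylComparable f a b) :
    cylComparable f b a :=
  h.symm

theorem cylLE.specializes {f : C(X, Y)} {a b : X ⊕ Y} (h : cylLE f a b) :
    Sum.elim f id a ⤳ Sum.elim f id b := by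
  rcases a with a | a <;> rcases b with b | b
  · exact Specializes.map (x := a) (y := b) h f.continuous
  · exact h
  · exact h.elim
  · exact h

/-- The order complex of the mapping cylinder. -/
def cylinderComplex (f : X → Y) : AbstractSimplicialComplex (X ⊕ Y) where
  toPreAbstractSimplicialComplex := cliqueComplex (cylComparable f) Set.univ
  singleton_mem v := ⟨Finset.singleton_nonempty v, fun _ _ => Set.mem_univ _, by
    simpa using cylComparable_refl f v⟩

theorem image_mem_cylinderComplex_iff [inst : DecidableEq (X ⊕ Y)] {Z : Type u} [TopologicalSpace Z]
    {f : X → Y} {e : Z → X ⊕ Y} (he : ∀ a b, cylComparable f (e a) (e b) ↔ Comparable a b)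
    {s : Finset Z} : s.image e ∈ cylinderComplex f ↔ s ∈ orderComplex Z := by
  rw [mem_orderComplex_iff]
  refine and_congr Finset.image_nonempty ((and_iff_right fun _ _ => Set.mem_univ _).trans ?_)
  simp only [Finset.forall_mem_image, he]

/-- The inclusion of the domain in the mapping cylinder. -/
def cylinderInl (f : X → Y) : SimplicialMap (orderComplex X) (cylinderComplex f) where
  toFun := Sum.inl
  image_mem _ hs := (image_mem_cylinderComplex_iff (inst := _) fun _ _ => Iff.rfl).2 hs

/-- The inclusion of the codomain in the mapping cylinder. -/
def cylinderInr (f : X → Y) : SimplicialMap (orderComplex Y) (cylinderComplex f) where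
  toFun := Sum.inr
  image_mem _ hs := (image_mem_cylinderComplex_iff (inst := _) fun _ _ => Iff.rfl).2 hs

open Classical in
/-- The retraction of the mapping cylinder to the codomain. -/
def cylinderProj (f : C(X, Y)) : SimplicialMap (cylinderComplex f) (orderComplex Y) where
  toFun := Sum.elim f id
  image_mem s hs := by
    refine mem_orderComplex_iff.2 ⟨hs.1.image _, ?_⟩
    simp only [Finset.forall_mem_image]
    exact fun a ha b hb => (hs.2.2 a ha b hb).imp cylLE.specializes cylLE.specializes

theorem linkIsJoin_cylinder_inl (f : C(X, Y)) {T : Set X} {x : X}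
    (hmax : ∀ w ∈ T, x ⤳ w → w = x) :
    LinkIsJoin (cylComparable f) (Set.range Sum.inr ∪ Sum.inl '' T) {Sum.inr (f x)}
      (Sum.inl x) where
  subset := Set.singleton_subset_iff.2 (.inl ⟨_, rfl⟩)
  notMem := Sum.inl_ne_inr
  adj := forall_eq.2 (.inl (specializes_rfl (x := f x)))
  neighbor := by
    simp only [Set.mem_singleton_iff, forall_eq]
    rintro _ (⟨y, rfl⟩ | ⟨w, hw, rfl⟩) (h | h)
    · exact .inr (.inr (.inr h))
    · exact h.elim
    · exact .inl (congrArg Sum.inl (hmax w hw h))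
    · exact .inr (.inr (.inl (Specializes.map (x := w) (y := x) h f.continuous)))

theorem linkIsJoin_cylinder_inr (f : X → Y) {T : Set Y} {y : Y} (hmin : ∀ w ∈ T, w ⤳ y → w = y) :
    LinkIsJoin (cylComparable f) (Set.range Sum.inl ∪ Sum.inr '' T) (Sum.inl '' {x | f x ⤳ y})
      (Sum.inr y) where
  subset := (Set.image_subset_range _ _).trans Set.subset_union_left
  notMem := by simp
  adj := Set.forall_mem_image.2 fun _ hx => .inr hx
  neighbor := by
    simp only [Set.forall_mem_image]
    rintro _ (⟨x, rfl⟩ | ⟨w, hw, rfl⟩) (h | h)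
    · exact h.elim
    · exact .inr (.inl ⟨x, h, rfl⟩)
    · exact .inr (.inr fun _ hx => .inr (Specializes.trans hx h))
    · exact .inl (congrArg Sum.inr (hmin w hw h))

theorem IsDistinguished.dismantlable_inl [Finite X] [T0Space X] {f : C(X, Y)}
    (hf : IsDistinguished f) (y : Y) :
    Dismantlable (cylComparable f) (Sum.inl '' {x | f x ⤳ y}) := by
  have := isDistinguished_iff.1 hf y
  have himage := (dismantlable_univ (X := {x // f x ⤳ y})).image (r' := cylComparable f)
    (Sum.inl_injective.comp Subtype.val_injective)
    fun _ _ => or_congr subtype_specializes_iff.symm subtype_specializes_iff.symm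
  rwa [Set.image_univ, Set.range_comp, Subtype.range_coe_subtype] at himage

variable [Finite X] [Finite Y]

theorem isExpansion_cylinderInr [T0Space X] (f : C(X, Y)) : IsExpansion (cylinderInr f) := by
  classical
  refine isExpansion_of_collapses Sum.inr_injective
    (fun _ => (image_mem_cylinderComplex_iff fun _ _ => Iff.rfl).1)
    (fun _ => mem_cliqueComplex_iff_univ) ?_
  have hcollapse := collapses_cliqueComplex_of_linkIsJoin (cylComparable_refl f)
    (cylComparable_symm f) Sum.inl_injective (A := Set.range Sum.inr) (by simp) fun T hT => by
      obtain ⟨x, hx, hmax⟩ := exists_maximal_specializes hT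
      exact ⟨x, hx, _, .single _, linkIsJoin_cylinder_inl f hmax⟩
  rwa [Set.union_comm, Set.range_inl_union_range_inr] at hcollapse

theorem isExpansion_cylinderInl [T0Space X] [T0Space Y] {f : C(X, Y)} (hf : IsDistinguished f) :
    IsExpansion (cylinderInl f) := by
  classical
  refine isExpansion_of_collapses Sum.inl_injective
    (fun _ => (image_mem_cylinderComplex_iff fun _ _ => Iff.rfl).1)
    (fun _ => mem_cliqueComplex_iff_univ) ?_
  have hcollapse := collapses_cliqueComplex_of_linkIsJoin (cylComparable_refl f)
    (cylComparable_symm f) Sum.inr_injective (A := Set.range Sum.inl) (by simp) fun T hT => by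
      obtain ⟨y, hy, hmin⟩ := exists_minimal_specializes hT
      exact ⟨y, hy, _, hf.dismantlable_inl y, linkIsJoin_cylinder_inr f hmin⟩
  rwa [Set.range_inl_union_range_inr] at hcollapse

end Cylinder

section OrderComplexMap

variable {X Y Z : Type u} [TopologicalSpace X] [Fintype X] [TopologicalSpace Y] [Fintype Y]
  [TopologicalSpace Z] [Fintype Z]

theorem IsDistinguished.isSimpleHomotopyEquiv [T0Space X] [T0Space Y] {f : C(X, Y)}
    (hf : IsDistinguished f) : IsSimpleHomotopyEquiv (orderComplexMap f).realization :=
  isSimpleHomotopyEquiv_of_cylinder (cylinderProj f) (isExpansion_cylinderInl hf)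
    (isExpansion_cylinderInr f) rfl rfl

theorem realization_orderComplexMap_comp (f : C(Y, Z)) (g : C(X, Y)) :
    (orderComplexMap (f.comp g)).realization =
      (orderComplexMap f).realization.comp (orderComplexMap g).realization :=
  realization_comp (orderComplexMap f) (orderComplexMap g)

/-- The two ends of `X × Prop` are sections of the distinguished projection to `X`, whose
realization is a homotopy equivalence. -/
theorem homotopic_realization_of_specializes [T0Space X] {f g : C(X, Y)} (h : ∀ x, f x ⤳ g x) :
    (orderComplexMap f).realization.Homotopic (orderComplexMap g).realization := by
  classical
  let incl : Prop → C(X, X × Prop) := fun p => ⟨fun x => (x, p), by fun_prop⟩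
  have hsections : (orderComplexMap (incl True)).realization.Homotopic
      (orderComplexMap (incl False)).realization := by
    refine isDistinguished_fst_prop.isSimpleHomotopyEquiv.cancel_left ?_
    rw [← realization_orderComplexMap_comp, ← realization_orderComplexMap_comp]
    exact .refl _
  let H := sierpinskiHomotopy f g h
  have hf : H.comp (incl True) = f := ContinuousMap.ext (sierpinskiHomotopy_true h)
  have hg : H.comp (incl False) = g := ContinuousMap.ext (sierpinskiHomotopy_false h)
  rw [← hf, ← hg, realization_orderComplexMap_comp, realization_orderComplexMap_comp]
  exact .comp (.refl _) hsections

theorem homotopic_realization_orderComplexMap [T0Space X] {f g : C(X, Y)} (h : f.Homotopic g) :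
    (orderComplexMap f).realization.Homotopic (orderComplexMap g).realization := by
  have hfg := eqvGen_of_homotopic h
  clear h
  induction hfg with
  | rel f g h => exact homotopic_realization_of_specializes h
  | refl => exact .refl _
  | symm _ _ _ ih => exact ih.symm
  | trans _ _ _ _ _ ih₁ ih₂ => exact ih₁.trans ih₂

theorem homotopic_realization_comp [T0Space X] {f : C(Y, Z)} {g : C(X, Y)} {h : C(X, Z)}
    (hfg : (f.comp g).Homotopic h) :
    ((orderComplexMap f).realization.comp (orderComplexMap g).realization).Homotopic
      (orderComplexMap h).realization := by
  rw [← realization_orderComplexMap_comp]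
  exact homotopic_realization_orderComplexMap hfg

end OrderComplexMap

theorem InDBar.isSimpleHomotopyEquiv {X Y : Type u} [TopologicalSpace X] [Fintype X] [T0Space X]
    [TopologicalSpace Y] [Fintype Y] [T0Space Y] {f : C(X, Y)} (hf : InDBar f) :
    IsSimpleHomotopyEquiv (orderComplexMap f).realization := by
  suffices ∀ {X Y : Type u} [TopologicalSpace X] [Finite X] [T0Space X]
      [TopologicalSpace Y] [Finite Y] [T0Space Y] {f : C(X, Y)}, InDBar f →
      ∀ [Fintype X] [Fintype Y], IsSimpleHomotopyEquiv (orderComplexMap f).realization from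
    this hf
  intro X Y _ _ _ _ _ _ f hf
  induction hf with
  | base h => exact fun {_ _} => IsDistinguished.isSimpleHomotopyEquiv h
  | @comp _ Y _ _ _ _ _ _ _ _ _ _ _ _ _ hfg _ _ ih_f ih_g =>
    intro _ _
    have := Fintype.ofFinite Y
    exact (ih_f.comp ih_g).congr (homotopic_realization_comp hfg)
  | @left X _ _ _ _ _ _ _ _ _ _ _ _ _ _ hfg _ _ ih_g ih_h =>
    intro _ _
    have := Fintype.ofFinite X
    exact .of_comp_left ih_g (ih_h.congr (homotopic_realization_comp hfg).symm)
  | @right _ _ Z _ _ _ _ _ _ _ _ _ _ _ _ hfg _ _ ih_f ih_h =>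
    intro _ _
    have := Fintype.ofFinite Z
    exact .of_comp_right ih_f (ih_h.congr (homotopic_realization_comp hfg).symm)

/-! ### Barycentric subdivision -/

section Barycentric

variable {V W : Type u} {K : AbstractSimplicialComplex V} {L : AbstractSimplicialComplex W}

noncomputable instance [Finite V] : Fintype (FaceSpace K) := Fintype.ofFinite _

open Classical in
/-- A map of vertices which sends each simplex into some simplex is simplicial. -/
def SimplicialMap.ofSubset (f : V → W) (h : ∀ s ∈ K, ∃ t ∈ L, ∀ v ∈ s, f v ∈ t) :
    SimplicialMap K L where
  toFun := f
  image_mem s hs := by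
    obtain ⟨t, ht, hst⟩ := h s hs
    exact mem_of_subset ht (Finset.image_subset_iff.2 hst) ((nonempty_of_mem hs).image f)

theorem contiguous_of_subset {φ ψ : SimplicialMap K L}
    (h : ∀ s ∈ K, ∃ t ∈ L, ∀ v ∈ s, φ.toFun v ∈ t ∧ ψ.toFun v ∈ t) : Contiguous φ ψ := by
  classical
  intro s hs
  obtain ⟨t, ht, hst⟩ := h s hs
  exact mem_of_subset ht (Finset.union_subset (Finset.image_subset_iff.2 fun v hv => (hst v hv).1)
    (Finset.image_subset_iff.2 fun v hv => (hst v hv).2))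
    (((nonempty_of_mem hs).image _).mono Finset.subset_union_left)

theorem exists_max_of_comparable {X : Type u} [TopologicalSpace X] {c : Finset X}
    (hc : c.Nonempty) (h : ∀ a ∈ c, ∀ b ∈ c, Comparable a b) : ∃ m ∈ c, ∀ x ∈ c, x ⤳ m := by
  let _ := specializationPreorder X
  obtain ⟨m, hm⟩ := c.finite_toSet.exists_minimal hc
  exact ⟨m, hm.1, fun x hx => (h x hx m hm.1).elim id fun hmx => hm.2 hx hmx⟩

theorem exists_face_of_comparable {c : Finset (FaceSpace K)} (hc : c.Nonempty)
    (h : ∀ a ∈ c, ∀ b ∈ c, Comparable a b) : ∃ m ∈ c, ∀ s ∈ c, s.1 ⊆ m.1 := by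
  obtain ⟨m, hm, hmax⟩ := exists_max_of_comparable hc h
  exact ⟨m, hm, fun s hs => FaceSpace.specializes_iff.1 (hmax s hs)⟩

theorem exists_face_of_chain {c : Finset (FaceSpace K)} (hc : c ∈ orderComplex (FaceSpace K)) :
    ∃ m ∈ c, ∀ s ∈ c, s.1 ⊆ m.1 :=
  exists_face_of_comparable (nonempty_of_mem hc) (mem_orderComplex_iff.1 hc).2

theorem FaceSpace.nonempty (s : FaceSpace K) : s.1.Nonempty := nonempty_of_mem s.2

/-- A vertex of the simplex `s`. -/
noncomputable def chosenVertex (s : FaceSpace K) : V := s.nonempty.choose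

theorem chosenVertex_mem (s : FaceSpace K) : chosenVertex s ∈ s.1 := s.nonempty.choose_spec

/-- A simplicial approximation of the identity, from the barycentric subdivision of `K` to `K`. -/
noncomputable def subdivisionMap (K : AbstractSimplicialComplex V) :
    SimplicialMap (orderComplex (FaceSpace K)) K :=
  .ofSubset chosenVertex fun _ hc =>
    let ⟨m, _, hmax⟩ := exists_face_of_chain hc
    ⟨m.1, m.2, fun s hs => hmax s hs (chosenVertex_mem s)⟩

theorem contiguous_subdivisionMap (φ : SimplicialMap K L) :
    Contiguous (φ.comp (subdivisionMap K))
      ((subdivisionMap L).comp (orderComplexMap (faceSpaceMap φ))) := by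
  classical
  refine contiguous_of_subset fun c hc => ?_
  obtain ⟨m, -, hmax⟩ := exists_face_of_chain hc
  exact ⟨(faceSpaceMap φ m).1, (faceSpaceMap φ m).2, fun s hs =>
    ⟨Finset.mem_image_of_mem _ (hmax s hs (chosenVertex_mem s)),
      Finset.image_subset_image (hmax s hs) (chosenVertex_mem (faceSpaceMap φ s))⟩⟩

/-- The join of a chain of simplices of `K` with a simplex of `K` contained in all of them, where
one of the two may be empty: these are the simplices of the mapping cylinder of the subdivision
map. -/
structure IsFlagJoin (K : AbstractSimplicialComplex V) (t : Finset (FaceSpace K ⊕ V)) : Prop where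
  nonempty : t.Nonempty
  comparable : ∀ s ∈ t.toLeft, ∀ s' ∈ t.toLeft, Comparable s s'
  subset : ∀ s ∈ t.toLeft, t.toRight ⊆ s.1
  mem : t.toRight.Nonempty → t.toRight ∈ K

theorem IsFlagJoin.mono {t t' : Finset (FaceSpace K ⊕ V)} (h : IsFlagJoin K t) (htt' : t' ⊆ t)
    (ht' : t'.Nonempty) : IsFlagJoin K t' where
  nonempty := ht'
  comparable s hs s' hs' := h.comparable s (Finset.toLeft_subset_toLeft htt' hs) s'
    (Finset.toLeft_subset_toLeft htt' hs')
  subset s hs := (Finset.toRight_subset_toRight htt').trans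
    (h.subset s (Finset.toLeft_subset_toLeft htt' hs))
  mem hne := mem_of_subset (h.mem (hne.mono (Finset.toRight_subset_toRight htt')))
    (Finset.toRight_subset_toRight htt') hne

theorem isFlagJoin_image_inl_iff [inst : DecidableEq (FaceSpace K ⊕ V)] {c : Finset (FaceSpace K)} :
    IsFlagJoin K (c.image Sum.inl) ↔ c ∈ orderComplex (FaceSpace K) := by
  have hleft : (c.image Sum.inl : Finset (FaceSpace K ⊕ V)).toLeft = c := by ext; simp
  have hright : (c.image Sum.inl : Finset (FaceSpace K ⊕ V)).toRight = ∅ := by ext; simp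
  rw [mem_orderComplex_iff]
  refine ⟨fun h => ⟨h.nonempty.of_image, hleft ▸ h.comparable⟩, fun h => ⟨h.1.image _, ?_, ?_, ?_⟩⟩
  · rw [hleft]
    exact h.2
  · simp [hright]
  · simp [hright]

theorem isFlagJoin_image_inr_iff [inst : DecidableEq (FaceSpace K ⊕ V)] {s : Finset V} :
    IsFlagJoin K (s.image Sum.inr) ↔ s ∈ K := by
  have hleft : (s.image Sum.inr : Finset (FaceSpace K ⊕ V)).toLeft = ∅ := by ext; simp
  have hright : (s.image Sum.inr : Finset (FaceSpace K ⊕ V)).toRight = s := by ext; simp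
  refine ⟨fun h => ?_, fun h => ⟨(nonempty_of_mem h).image _, ?_, ?_, ?_⟩⟩
  · simpa only [hright, h.nonempty.of_image, forall_true_left] using h.mem
  · simp [hleft]
  · simp [hleft]
  · simpa only [hright] using fun _ => h

/-- The mapping cylinder of the subdivision map. -/
def subdivisionCylinder (K : AbstractSimplicialComplex V) :
    AbstractSimplicialComplex (FaceSpace K ⊕ V) where
  faces := {t | IsFlagJoin K t}
  isRelLowerSet_faces := fun _ ht => ⟨ht.nonempty, fun _ => ht.mono⟩
  singleton_mem := by
    classical
    rintro (s | v)
    · exact isFlagJoin_image_inl_iff.2 ((orderComplex (FaceSpace K)).singleton_mem s)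
    · exact isFlagJoin_image_inr_iff.2 (K.singleton_mem v)

/-- The inclusion of `K` in the cylinder. -/
def subdivisionInr (K : AbstractSimplicialComplex V) :
    SimplicialMap K (subdivisionCylinder K) where
  toFun := Sum.inr
  image_mem _ hs := (isFlagJoin_image_inr_iff (inst := _)).2 hs

/-- The inclusion of the barycentric subdivision in the cylinder. -/
def subdivisionInl (K : AbstractSimplicialComplex V) :
    SimplicialMap (orderComplex (FaceSpace K)) (subdivisionCylinder K) where
  toFun := Sum.inl
  image_mem _ hc := (isFlagJoin_image_inl_iff (inst := _)).2 hc

/-- The retraction of the cylinder to `K`. -/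
noncomputable def subdivisionProj (K : AbstractSimplicialComplex V) :
    SimplicialMap (subdivisionCylinder K) K :=
  .ofSubset (Sum.elim chosenVertex id) fun t ht => by
    rcases t.toLeft.eq_empty_or_nonempty with hleft | hleft
    · have hinl : ∀ s, Sum.inl s ∉ t := fun s hs =>
        Finset.notMem_empty s (hleft ▸ Finset.mem_toLeft.2 hs)
      refine ⟨t.toRight, ht.mem ?_, ?_⟩
      · obtain ⟨s | v, hv⟩ := ht.nonempty
        · exact (hinl s hv).elim
        · exact ⟨v, Finset.mem_toRight.2 hv⟩
      · rintro (s | v) hv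
        · exact (hinl s hv).elim
        · exact Finset.mem_toRight.2 hv
    · obtain ⟨m, hm, hmax⟩ := exists_face_of_comparable hleft ht.comparable
      refine ⟨m.1, m.2, ?_⟩
      rintro (s | v) hv
      · exact hmax s (Finset.mem_toLeft.2 hv) (chosenVertex_mem s)
      · exact ht.subset m hm (Finset.mem_toRight.2 hv)

/-- The joins of a chain of simplices which all belong to `T` with a simplex of `K`. They
interpolate between `K` and the cylinder. -/
def leftFiltration (K : AbstractSimplicialComplex V) (T : Set (FaceSpace K)) :
    PreAbstractSimplicialComplex (FaceSpace K ⊕ V) where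
  faces := {t | IsFlagJoin K t ∧ ∀ s ∈ t.toLeft, s ∈ T}
  isRelLowerSet_faces := fun _ ht => ⟨ht.1.nonempty, fun _ htt' ht' =>
    ⟨ht.1.mono htt' ht', fun s hs => ht.2 s (Finset.toLeft_subset_toLeft htt' hs)⟩⟩

/-- The joins of a chain of simplices with a simplex of `K` all of whose faces belong to `T`. They
interpolate between the barycentric subdivision and the cylinder. -/
def rightFiltration (K : AbstractSimplicialComplex V) (T : Set (FaceSpace K)) :
    PreAbstractSimplicialComplex (FaceSpace K ⊕ V) where
  faces := {t | IsFlagJoin K t ∧ ∀ s : FaceSpace K, s.1 ⊆ t.toRight → s ∈ T}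
  isRelLowerSet_faces := fun _ ht => ⟨ht.1.nonempty, fun _ htt' ht' =>
    ⟨ht.1.mono htt' ht', fun s hs => ht.2 s (hs.trans (Finset.toRight_subset_toRight htt'))⟩⟩

theorem leftFiltration_univ :
    leftFiltration K Set.univ = (subdivisionCylinder K).toPreAbstractSimplicialComplex :=
  preAbstractSimplicialComplex_ext fun _ => and_iff_left fun _ _ => Set.mem_univ _

theorem rightFiltration_univ :
    rightFiltration K Set.univ = (subdivisionCylinder K).toPreAbstractSimplicialComplex :=
  preAbstractSimplicialComplex_ext fun _ => and_iff_left fun _ _ => Set.mem_univ _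

theorem mem_leftFiltration_empty_iff {t : Finset (FaceSpace K ⊕ V)} :
    t ∈ leftFiltration K ∅ ↔
      t ∈ subdivisionCylinder K ∧ ∀ w ∈ t, w ∈ Set.range (subdivisionInr K).toFun := by
  refine and_congr_right fun _ => ?_
  rw [Sum.forall]
  simp [subdivisionInr]

theorem mem_rightFiltration_empty_iff {t : Finset (FaceSpace K ⊕ V)} :
    t ∈ rightFiltration K ∅ ↔
      t ∈ subdivisionCylinder K ∧ ∀ w ∈ t, w ∈ Set.range (subdivisionInl K).toFun := by
  refine and_congr_right fun ht => ?_
  have hright : (∀ s : FaceSpace K, s.1 ⊆ t.toRight → s ∈ (∅ : Set (FaceSpace K))) ↔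
      t.toRight = ∅ := by
    refine ⟨fun h => Finset.not_nonempty_iff_eq_empty.1 fun hne => h ⟨_, ht.mem hne⟩ subset_rfl,
      fun h s hs => ?_⟩
    exact absurd (Finset.subset_empty.1 (h ▸ hs)) s.nonempty.ne_empty
  rw [hright, Sum.forall]
  simp [subdivisionInl, Finset.eq_empty_iff_forall_notMem]

theorem IsFlagJoin.insert_inr [DecidableEq (FaceSpace K)] [DecidableEq V]
    {t : Finset (FaceSpace K ⊕ V)} (ht : IsFlagJoin K t) {x : FaceSpace K} (hx : x ∈ t.toLeft)
    (hmin : ∀ s ∈ t.toLeft, x.1 ⊆ s.1) {v : V} (hv : v ∈ x.1) :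
    IsFlagJoin K (insert (.inr v) t) where
  nonempty := Finset.insert_nonempty _ _
  comparable := by simpa only [Finset.toLeft_insert_inr] using ht.comparable
  subset s hs := by
    rw [Finset.toLeft_insert_inr] at hs
    rw [Finset.toRight_insert_inr]
    exact Finset.insert_subset (hmin s hs hv) (ht.subset s hs)
  mem hne := by
    rw [Finset.toRight_insert_inr] at hne ⊢
    exact mem_of_subset x.2 (Finset.insert_subset hv (ht.subset x hx)) hne

theorem IsFlagJoin.insert_inl [DecidableEq (FaceSpace K)] [DecidableEq V]
    {t : Finset (FaceSpace K ⊕ V)} (ht : IsFlagJoin K t) {x : FaceSpace K} (hx : t.toRight = x.1) :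
    IsFlagJoin K (insert (.inl x) t) where
  nonempty := Finset.insert_nonempty _ _
  comparable := by
    have hxs : ∀ s ∈ t.toLeft, x ⤳ s := fun s hs =>
      FaceSpace.specializes_iff.2 (hx ▸ ht.subset s hs)
    rw [Finset.toLeft_insert_inl]
    simp only [Finset.forall_mem_insert]
    exact ⟨⟨.inl specializes_rfl, fun s hs => .inl (hxs s hs)⟩,
      fun s hs => ⟨.inr (hxs s hs), ht.comparable s hs⟩⟩
  subset := by
    rw [Finset.toLeft_insert_inl, Finset.toRight_insert_inl, Finset.forall_mem_insert]
    exact ⟨hx.subset, ht.subset⟩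
  mem := by simpa only [Finset.toRight_insert_inl] using ht.mem

theorem collapses_leftFiltration_sdiff [Finite V] {T : Set (FaceSpace K)} {x : FaceSpace K}
    (hmin : ∀ s ∈ T, s ⤳ x → s = x) :
    Collapses (leftFiltration K T) (leftFiltration K (T \ {x})) := by
  classical
  refine collapses_of_toggle (fun t ht => ⟨ht.1, fun s hs => (ht.2 s hs).1⟩)
    (.inr (chosenVertex x)) fun t ht htx => ?_
  have hx : x ∈ t.toLeft := by
    by_contra hx
    exact htx ⟨ht.1, fun s hs => ⟨ht.2 s hs, ne_of_mem_of_not_mem hs hx⟩⟩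
  have hbelow : ∀ s ∈ t.toLeft, x.1 ⊆ s.1 := fun s hs =>
    (ht.1.comparable s hs x hx).elim (fun hsx => (hmin s (ht.2 s hs) hsx) ▸ subset_rfl)
      FaceSpace.specializes_iff.1
  have hx_erase : Sum.inl x ∈ t.erase (.inr (chosenVertex x)) :=
    Finset.mem_erase_of_ne_of_mem Sum.inl_ne_inr (Finset.mem_toLeft.1 hx)
  refine ⟨⟨ht.1.insert_inr hx hbelow (chosenVertex_mem x), ?_⟩,
    mem_pre_of_subset ht (Finset.erase_subset _ _) ⟨_, hx_erase⟩,
    fun h => (h.2 x (Finset.mem_toLeft.2 hx_erase)).2 rfl⟩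
  simpa only [Finset.toLeft_insert_inr] using ht.2

theorem collapses_rightFiltration_sdiff [Finite V] {T : Set (FaceSpace K)} {x : FaceSpace K}
    (hmax : ∀ s ∈ T, x ⤳ s → s = x) :
    Collapses (rightFiltration K T) (rightFiltration K (T \ {x})) := by
  classical
  refine collapses_of_toggle (fun t ht => ⟨ht.1, fun s hs => (ht.2 s hs).1⟩)
    (.inl x) fun t ht htx => ?_
  have hxt : x.1 ⊆ t.toRight := by
    by_contra hxt
    exact htx ⟨ht.1, fun s hs => ⟨ht.2 s hs, fun hsx => hxt (hsx ▸ hs)⟩⟩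
  have htK : t.toRight ∈ K := ht.1.mem (x.nonempty.mono hxt)
  have hx : t.toRight = x.1 := congrArg Subtype.val
    (hmax ⟨t.toRight, htK⟩ (ht.2 _ subset_rfl) (FaceSpace.specializes_iff.2 hxt))
  have herase : (t.erase (.inl x)).toRight = t.toRight := by ext; simp
  have herase_nonempty : (t.erase (.inl x)).Nonempty := by
    obtain ⟨v, hv⟩ := x.nonempty
    exact ⟨.inr v, Finset.mem_erase_of_ne_of_mem Sum.inr_ne_inl (Finset.mem_toRight.1 (hxt hv))⟩
  refine ⟨⟨ht.1.insert_inl hx, ?_⟩,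
    mem_pre_of_subset ht (Finset.erase_subset _ _) herase_nonempty,
    fun h => (h.2 x (herase ▸ hxt)).2 rfl⟩
  simpa only [Finset.toRight_insert_inl] using ht.2

theorem isExpansion_subdivisionInr [Finite V] : IsExpansion (subdivisionInr K) := by
  classical
  refine isExpansion_of_collapses Sum.inr_injective (fun _ => isFlagJoin_image_inr_iff.1)
    (fun _ => mem_leftFiltration_empty_iff) ?_
  rw [← leftFiltration_univ]
  refine collapses_of_forall_exists_removable _ (fun T hT => ?_) _
  obtain ⟨x, hx, hmin⟩ := exists_minimal_specializes hT
  exact ⟨x, hx, collapses_leftFiltration_sdiff hmin⟩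

theorem isExpansion_subdivisionInl [Finite V] : IsExpansion (subdivisionInl K) := by
  classical
  refine isExpansion_of_collapses Sum.inl_injective (fun _ => isFlagJoin_image_inl_iff.1)
    (fun _ => mem_rightFiltration_empty_iff) ?_
  rw [← rightFiltration_univ]
  refine collapses_of_forall_exists_removable _ (fun T hT => ?_) _
  obtain ⟨x, hx, hmax⟩ := exists_maximal_specializes hT
  exact ⟨x, hx, collapses_rightFiltration_sdiff hmax⟩

theorem isSimpleHomotopyEquiv_subdivisionMap [Fintype V] :
    IsSimpleHomotopyEquiv (subdivisionMap K).realization :=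
  isSimpleHomotopyEquiv_of_cylinder (subdivisionProj K) isExpansion_subdivisionInl
    isExpansion_subdivisionInr rfl rfl

theorem isSimpleHomotopyEquiv_of_inDBar_faceSpaceMap [Fintype V] [Fintype W]
    {φ : SimplicialMap K L} (h : InDBar (faceSpaceMap φ)) :
    IsSimpleHomotopyEquiv φ.realization := by
  refine .of_comp_left (isSimpleHomotopyEquiv_subdivisionMap (K := K)) ?_
  have hnatural := (contiguous_subdivisionMap φ).homotopic
  rw [realization_comp, realization_comp] at hnatural
  exact (isSimpleHomotopyEquiv_subdivisionMap.comp h.isSimpleHomotopyEquiv).congr hnatural.symm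

end Barycentric

/-! ### Face posets and the class generated by the distinguished maps -/

section FacePosets

variable {V W Z : Type u} {K : AbstractSimplicialComplex V} {L : AbstractSimplicialComplex W}
  {M : AbstractSimplicialComplex Z}

theorem faceSpaceMap_comp (ψ : SimplicialMap L M) (φ : SimplicialMap K L) :
    faceSpaceMap (ψ.comp φ) = (faceSpaceMap ψ).comp (faceSpaceMap φ) := by
  classical
  ext1 s
  exact Subtype.ext (Finset.image_image (s := s.1) (f := φ.toFun) (g := ψ.toFun)).symm

theorem inDBar_faceSpaceMap_id [Finite V] (K : AbstractSimplicialComplex V) :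
    InDBar (faceSpaceMap (SimplicialMap.id K)) := by
  classical
  have hid : faceSpaceMap (SimplicialMap.id K) = ContinuousMap.id (FaceSpace K) := by
    ext1 s
    exact Subtype.ext (Finset.image_id (s := s.1))
  exact hid ▸ .id

open Classical in
theorem Contiguous.homotopic_faceSpaceMap [Finite V] {φ ψ : SimplicialMap K L}
    (h : Contiguous φ ψ) : (faceSpaceMap φ).Homotopic (faceSpaceMap ψ) := by
  let union : C(FaceSpace K, FaceSpace L) :=
    ⟨fun s => ⟨s.1.image φ.toFun ∪ s.1.image ψ.toFun, h s.1 s.2⟩,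
      continuous_of_specializes fun s t hst => FaceSpace.specializes_iff.2
        (Finset.union_subset_union (Finset.image_subset_image (FaceSpace.specializes_iff.1 hst))
          (Finset.image_subset_image (FaceSpace.specializes_iff.1 hst)))⟩
  have hφ : (faceSpaceMap φ).Homotopic union := homotopic_of_specializes fun s =>
    FaceSpace.specializes_iff.2 Finset.subset_union_left
  have hψ : (faceSpaceMap ψ).Homotopic union := homotopic_of_specializes fun s =>
    FaceSpace.specializes_iff.2 Finset.subset_union_right
  exact hφ.trans hψ.symm

theorem Contiguous.inDBar_iff [Finite V] [Finite W] {φ ψ : SimplicialMap K L}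
    (h : Contiguous φ ψ) : InDBar (faceSpaceMap φ) ↔ InDBar (faceSpaceMap ψ) :=
  ⟨.congr h.homotopic_faceSpaceMap, .congr h.homotopic_faceSpaceMap.symm⟩

theorem contractibleSpace_of_cone {X : Type u} [TopologicalSpace X] [AlexandrovDiscrete X]
    [DecidableEq V] {e : X → Finset V} (he : ∀ x y, x ⤳ y ↔ e x ⊆ e y) {a : V} {m : X}
    (hm : e m = {a}) (hinsert : ∀ x, ∃ y, e y = insert a (e x)) : ContractibleSpace X := by
  choose g hg using hinsert
  have hcont : Continuous g := continuous_of_specializes fun x y hxy => by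
    rw [he, hg, hg]
    exact Finset.insert_subset_insert a ((he x y).1 hxy)
  refine contractibleSpace_of_fence ⟨g, hcont⟩ m (fun x => ?_) fun x => ?_
  · rw [he, ContinuousMap.coe_mk, hg]
    exact Finset.subset_insert a _
  · rw [he, ContinuousMap.coe_mk, hg, hm, Finset.singleton_subset_iff]
    exact Finset.mem_insert_self a _

end FacePosets

section ChainMax

variable {X Y : Type u} [TopologicalSpace X] [Finite X] [TopologicalSpace Y] [Finite Y]

theorem exists_max_of_chain {X : Type u} [TopologicalSpace X] (c : FaceSpace (orderComplex X)) :
    ∃ m ∈ c.1, ∀ x ∈ c.1, x ⤳ m :=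
  exists_max_of_comparable c.nonempty (mem_orderComplex_iff.1 c.2).2

/-- The map which sends a chain to its maximum. -/
noncomputable def chainMax (X : Type u) [TopologicalSpace X] [Finite X] :
    C(FaceSpace (orderComplex X), X) where
  toFun c := (exists_max_of_chain c).choose
  continuous_toFun := continuous_of_specializes fun c d hcd =>
    (exists_max_of_chain d).choose_spec.2 _
      (FaceSpace.specializes_iff.1 hcd (exists_max_of_chain c).choose_spec.1)

theorem chainMax_mem (c : FaceSpace (orderComplex X)) : chainMax X c ∈ c.1 :=
  (exists_max_of_chain c).choose_spec.1

theorem specializes_chainMax (c : FaceSpace (orderComplex X)) {x : X} (hx : x ∈ c.1) :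
    x ⤳ chainMax X c :=
  (exists_max_of_chain c).choose_spec.2 x hx

theorem chainMax_specializes_iff (c : FaceSpace (orderComplex X)) {y : X} :
    chainMax X c ⤳ y ↔ ∀ x ∈ c.1, x ⤳ y :=
  ⟨fun h _ hx => (specializes_chainMax c hx).trans h, fun h => h _ (chainMax_mem c)⟩

theorem insert_mem_orderComplex {X : Type u} [TopologicalSpace X] [DecidableEq X] {s : Finset X}
    {y : X} (hs : s ∈ orderComplex X) (hy : ∀ x ∈ s, x ⤳ y) : insert y s ∈ orderComplex X := by
  refine mem_orderComplex_iff.2 ⟨Finset.insert_nonempty _ _, ?_⟩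
  simp only [Finset.forall_mem_insert]
  exact ⟨⟨.inl specializes_rfl, fun x hx => .inr (hy x hx)⟩,
    fun x hx => ⟨.inl (hy x hx), (mem_orderComplex_iff.1 hs).2 x hx⟩⟩

/-- The chains bounded above by `y` form a cone with apex `y`. -/
theorem isDistinguished_chainMax : IsDistinguished (chainMax X) := by
  classical
  refine isDistinguished_iff.2 fun y => ?_
  have hy : chainMax X ⟨{y}, (orderComplex X).singleton_mem y⟩ ⤳ y :=
    (chainMax_specializes_iff _).2 fun x hx => specializes_of_eq (Finset.mem_singleton.1 hx)
  refine contractibleSpace_of_cone (e := fun c => c.1.1) (m := ⟨_, hy⟩)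
    (fun _ _ => subtype_specializes_iff.trans FaceSpace.specializes_iff) rfl fun c => ?_
  have hc := (chainMax_specializes_iff c.1).1 c.2
  exact ⟨⟨⟨insert y c.1.1, insert_mem_orderComplex c.1.2 hc⟩, (chainMax_specializes_iff _).2
    ((Finset.forall_mem_insert _ _ _).2 ⟨specializes_rfl, hc⟩)⟩, rfl⟩

theorem homotopic_chainMax (f : C(X, Y)) : (f.comp (chainMax X)).Homotopic
    ((chainMax Y).comp (faceSpaceMap (orderComplexMap f))) := by
  classical
  exact homotopic_of_specializes fun c => specializes_chainMax
    (faceSpaceMap (orderComplexMap f) c) (Finset.mem_image_of_mem f (chainMax_mem c))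

theorem inDBar_iff_faceSpaceMap_orderComplexMap [T0Space X] [T0Space Y] (f : C(X, Y)) :
    InDBar f ↔ InDBar (faceSpaceMap (orderComplexMap f)) := by
  have hX : InDBar (chainMax X) := .of_isDistinguished isDistinguished_chainMax
  have hY : InDBar (chainMax Y) := .of_isDistinguished isDistinguished_chainMax
  exact ⟨fun h => .of_comp_right hY ((h.comp hX).congr (homotopic_chainMax f)),
    fun h => .of_comp_left hX ((hY.comp h).congr (homotopic_chainMax f).symm)⟩

theorem inDBar_subdivisionMap {V : Type u} [Finite V] {K : AbstractSimplicialComplex V} :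
    InDBar (faceSpaceMap (subdivisionMap K)) := by
  classical
  have hmax : InDBar (chainMax (FaceSpace K)) := .of_isDistinguished isDistinguished_chainMax
  refine hmax.congr (.symm (homotopic_of_specializes fun c => FaceSpace.specializes_iff.2 ?_))
  exact Finset.image_subset_iff.2 fun s hs =>
    FaceSpace.specializes_iff.1 (specializes_chainMax c hs) (chosenVertex_mem s)

end ChainMax

section FaceSet

variable {V W : Type u} {K : AbstractSimplicialComplex V} {L : AbstractSimplicialComplex W}
  {P : PreAbstractSimplicialComplex V} {S : Finset V} {a : V}

/-- The simplices of `K` which belong to the subcomplex `P`. -/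
def faceSet (K : AbstractSimplicialComplex V) (P : PreAbstractSimplicialComplex V) :
    Set (FaceSpace K) :=
  {T | T.1 ∈ P}

/-- The inclusion of the face poset of a subcomplex. -/
def faceSetIncl (K : AbstractSimplicialComplex V) (P : PreAbstractSimplicialComplex V) :
    C(faceSet K P, FaceSpace K) :=
  ⟨Subtype.val, continuous_subtype_val⟩

theorem faceSet_specializes_iff {T T' : faceSet K P} : T ⤳ T' ↔ T.1.1 ⊆ T'.1.1 :=
  subtype_specializes_iff.trans FaceSpace.specializes_iff

theorem faceSet_deleteFace_subset : faceSet K (deleteFace P S) ⊆ faceSet K P :=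
  fun _ hT => deleteFace_le P S hT

namespace IsFreeFace

variable [DecidableEq V] (h : IsFreeFace P S a) (hPK : P ≤ K.toPreAbstractSimplicialComplex)

/-- The free face `S`, as a point of the face poset. -/
def face : faceSet K P := ⟨⟨S, hPK h.mem⟩, h.mem⟩

/-- The simplex `aS`, as a point of the face poset. -/
def coface : faceSet K P := ⟨⟨insert a S, hPK h.insert_mem⟩, h.insert_mem⟩

theorem isBeatPoint : IsBeatPoint (h.face hPK) (h.coface hPK) where
  ne hne := Finset.insert_ne_self.2 h.notMem (congrArg (fun T => T.1.1) hne)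
  comparable := .inl (faceSet_specializes_iff.2 (Finset.subset_insert a S))
  below T _ hT := faceSet_specializes_iff.2
    ((faceSet_specializes_iff.1 hT).trans (Finset.subset_insert a S))
  above T hTS hST := by
    have hST := faceSet_specializes_iff.1 hST
    refine faceSet_specializes_iff.2 (((h.mem_iff T.1.1).1 ⟨T.2, hST⟩).resolve_left fun hT => ?_).ge
    exact hTS (Subtype.ext (Subtype.ext hT))

include h in
theorem insert_mem_deleteFace {t : Finset V} (ht : t ⊆ insert a S) (hSt : ¬ S ⊆ t) :
    insert a t ∈ deleteFace P S :=
  ⟨mem_pre_of_subset h.insert_mem (Finset.insert_subset (Finset.mem_insert_self a S) ht)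
    (Finset.insert_nonempty a t),
    fun hS => hSt ((Finset.subset_insert_iff_of_notMem h.notMem).1 hS)⟩

/-- The inclusion of the face poset of `deleteFace P S` in that of `P` without the point `S`. -/
def deleteFaceIncl : C(faceSet K (deleteFace P S), {T : faceSet K P // T ≠ h.face hPK}) where
  toFun T := ⟨⟨T.1, faceSet_deleteFace_subset T.2⟩, fun hT =>
    T.2.2 (congrArg (fun T => T.1.1) hT).ge⟩
  continuous_toFun := by fun_prop

theorem deleteFaceIncl_specializes_iff {T : faceSet K (deleteFace P S)}
    {T' : {T : faceSet K P // T ≠ h.face hPK}} :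
    h.deleteFaceIncl hPK T ⤳ T' ↔ T.1.1 ⊆ T'.1.1.1 :=
  subtype_specializes_iff.trans faceSet_specializes_iff

/-- The fibre over `aS` is the face poset of the cone `a ∂S`; all others have a maximum. -/
theorem isDistinguished_deleteFaceIncl [Finite V] : IsDistinguished (h.deleteFaceIncl hPK) := by
  refine isDistinguished_iff.2 fun T => ?_
  by_cases hT : S ⊆ T.1.1.1
  · have hTa : T.1.1.1 = insert a S := by
      refine ((h.mem_iff _).1 ⟨T.1.2, hT⟩).resolve_left fun hTS => ?_
      exact T.2 (Subtype.ext (Subtype.ext hTS))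
    have hle (T' : faceSet K (deleteFace P S)) :
        h.deleteFaceIncl hPK T' ⤳ T ↔ T'.1.1 ⊆ insert a S :=
      hTa ▸ h.deleteFaceIncl_specializes_iff hPK
    have hcone (t : Finset V) (ht : t ⊆ insert a S) (hSt : ¬ S ⊆ t) :
        ∃ T' : {T' // h.deleteFaceIncl hPK T' ⤳ T}, T'.1.1.1 = insert a t :=
      have hins := h.insert_mem_deleteFace ht hSt
      ⟨⟨⟨⟨insert a t, hPK hins.1⟩, hins⟩,
        (hle _).2 (Finset.insert_subset (Finset.mem_insert_self a S) ht)⟩, rfl⟩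
    obtain ⟨m, hm⟩ := hcone ∅ (Finset.empty_subset _) fun hS =>
      h.nonempty.ne_empty (Finset.subset_empty.1 hS)
    exact contractibleSpace_of_cone (e := fun T' => T'.1.1.1) (m := m)
      (fun _ _ => subtype_specializes_iff.trans faceSet_specializes_iff) hm
      fun T' => hcone _ ((hle _).1 T'.2) T'.1.2.2
  · exact contractibleSpace_of_forall_specializes ⟨⟨T.1.1, T.1.2, hT⟩, specializes_rfl⟩
      fun T' => subtype_specializes_iff.2
        (faceSet_specializes_iff.2 ((h.deleteFaceIncl_specializes_iff hPK).1 T'.2))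

end IsFreeFace

theorem inDBar_faceSetIncl_of_collapses [Finite V]
    (h : Collapses K.toPreAbstractSimplicialComplex P) : InDBar (faceSetIncl K P) := by
  classical
  induction h with
  | refl => exact .of_adjoint (fun T => ⟨T, T.2⟩) fun T T' =>
      (subtype_specializes_iff (x := T) (y := ⟨T', T'.2⟩)).symm
  | @tail P Q hKP hPQ ih =>
    obtain ⟨S, a, h, rfl⟩ := elementaryCollapse_iff.1 hPQ
    have hPK := Collapses.le hKP
    exact ih.comp ((h.isBeatPoint hPK).inDBar_inclCompl.comp
      (.of_isDistinguished (h.isDistinguished_deleteFaceIncl hPK)))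

theorem IsExpansion.inDBar [Finite V] [Finite W] {i : SimplicialMap K L} (hi : IsExpansion i) :
    InDBar (faceSpaceMap i) := by
  classical
  let image := faceSet L (K.toPreAbstractSimplicialComplex.map i.toFun)
  let corestriction : C(FaceSpace K, image) :=
    ⟨fun S => ⟨faceSpaceMap i S, S.1, S.2, rfl⟩, by fun_prop⟩
  suffices InDBar corestriction from (inDBar_faceSetIncl_of_collapses hi.2).comp this
  have hpreimage : ∀ T : image, ∃ s ∈ K, s.image i.toFun = T.1.1 := fun T => T.2
  choose s hs himage using hpreimage
  refine .of_adjoint (fun T => ⟨s T, hs T⟩) fun S T => faceSet_specializes_iff.trans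
    (Iff.trans ?_ FaceSpace.specializes_iff.symm)
  rw [← himage T]
  exact Finset.image_subset_image_iff hi.1

end FaceSet

/-! ### Simplicial approximation -/

section Average

variable {ι E : Type*} [SeminormedAddCommGroup E] [NormedSpace ℝ E] {s t : Finset ι} {f : ι → E}
  {D : ℝ}

theorem dist_average_le (h : ∀ a ∈ t, ∀ b ∈ t, dist (f a) (f b) ≤ D) {a : ι} (ha : a ∈ t) :
    dist (f a) ((t.card : ℝ)⁻¹ • ∑ b ∈ t, f b) ≤ (1 - (t.card : ℝ)⁻¹) * D := by
  classical
  have hcard : (0 : ℝ) < t.card := Nat.cast_pos.2 (Finset.card_pos.2 ⟨a, ha⟩)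
  have hsum : ∑ b ∈ t.erase a, (f a - f b) = (t.card : ℝ) • f a - ∑ b ∈ t, f b := by
    rw [Finset.sum_erase _ (sub_self _), Finset.sum_sub_distrib, Finset.sum_const,
      Nat.cast_smul_eq_nsmul]
  calc dist (f a) ((t.card : ℝ)⁻¹ • ∑ b ∈ t, f b)
      = (t.card : ℝ)⁻¹ * ‖∑ b ∈ t.erase a, (f a - f b)‖ := by
        rw [hsum, ← norm_smul_of_nonneg (inv_nonneg.2 hcard.le), smul_sub,
          inv_smul_smul₀ hcard.ne', dist_eq_norm]
    _ ≤ (t.card : ℝ)⁻¹ * ((t.erase a).card * D) := by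
        gcongr
        rw [← nsmul_eq_mul]
        exact (norm_sum_le _ _).trans (Finset.sum_le_card_nsmul _ _ _ fun b hb =>
          (dist_eq_norm (f a) (f b)).ge.trans (h a ha b (Finset.mem_of_mem_erase hb)))
    _ = (1 - (t.card : ℝ)⁻¹) * D := by
        rw [Finset.cast_card_erase_of_mem ha]
        field_simp

theorem dist_average_average_le (hst : s ⊆ t) (hs : s.Nonempty)
    (h : ∀ a ∈ t, ∀ b ∈ t, dist (f a) (f b) ≤ D) :
    dist ((s.card : ℝ)⁻¹ • ∑ a ∈ s, f a) ((t.card : ℝ)⁻¹ • ∑ b ∈ t, f b) ≤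
      (1 - (t.card : ℝ)⁻¹) * D := by
  have hcard : (0 : ℝ) < s.card := Nat.cast_pos.2 (Finset.card_pos.2 hs)
  rw [Finset.smul_sum]
  refine (convex_closedBall _ _).sum_mem (fun _ _ => inv_nonneg.2 hcard.le) ?_ fun a ha =>
    dist_average_le h (hst ha)
  rw [Finset.sum_const, nsmul_eq_mul, mul_inv_cancel₀ hcard.ne']

end Average

section Approximation

variable {V W : Type u} [Fintype V] [Fintype W] {K : AbstractSimplicialComplex V}
  {L : AbstractSimplicialComplex W}

open Classical in
/-- The barycenter of a simplex. -/
noncomputable def barycenter (s : FaceSpace K) : Realization K :=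
  ⟨⟨fun v => if v ∈ s.1 then (s.1.card : ℝ)⁻¹ else 0, fun v => by dsimp only; positivity, by
    have hcard : (s.1.card : ℝ) ≠ 0 := Nat.cast_ne_zero.2 (Finset.card_ne_zero.2 s.nonempty)
    rw [Finset.sum_ite_mem, Finset.univ_inter, Finset.sum_const, nsmul_eq_mul,
      mul_inv_cancel₀ hcard]⟩,
    s.1, s.2, fun _ => not_imp_comm.1 (if_neg ·)⟩

theorem barycenter_apply_of_mem {s : FaceSpace K} {v : V} (hv : v ∈ s.1) :
    (barycenter s).1 v = (s.1.card : ℝ)⁻¹ :=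
  if_pos hv

theorem carried_barycenter (s : FaceSpace K) : Carried (barycenter s) s.1 :=
  fun _ => not_imp_comm.1 (if_neg ·)

theorem barycenter_ne_zero {s : FaceSpace K} {v : V} (hv : v ∈ s.1) : (barycenter s).1 v ≠ 0 := by
  rw [barycenter_apply_of_mem hv]
  exact inv_ne_zero (Nat.cast_ne_zero.2 (Finset.card_ne_zero.2 s.nonempty))

/-- The star condition: the vertex map `f` sends every vertex of the carrier of a point `y` to a
vertex of the carrier of `g y`. -/
def IsSimplicialApproximation (f : V → W) (g : Realization K → Realization L) : Prop :=
  ∀ y w, y.1 w ≠ 0 → (g y).1 (f w) ≠ 0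

namespace IsSimplicialApproximation

variable {f : V → W} {g : Realization K → Realization L}

theorem mem_of_carried (h : IsSimplicialApproximation f g) {s : FaceSpace K} {t : Finset W}
    (ht : Carried (g (barycenter s)) t) {v : V} (hv : v ∈ s.1) : f v ∈ t :=
  ht _ (h _ v (barycenter_ne_zero hv))

theorem exists_image_subset (h : IsSimplicialApproximation f g) :
    ∀ s ∈ K, ∃ t ∈ L, ∀ v ∈ s, f v ∈ t := fun s hs =>
  let ⟨t, htL, ht⟩ := exists_carried (g (barycenter ⟨s, hs⟩))
  ⟨t, htL, fun _ hv => h.mem_of_carried (s := ⟨s, hs⟩) ht hv⟩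

theorem contiguous {φ ψ : SimplicialMap K L} (hφ : IsSimplicialApproximation φ.toFun g)
    (hψ : IsSimplicialApproximation ψ.toFun g) : Contiguous φ ψ :=
  contiguous_of_subset fun s hs =>
    let ⟨t, htL, ht⟩ := exists_carried (g (barycenter ⟨s, hs⟩))
    ⟨t, htL, fun _ hv => ⟨hφ.mem_of_carried (s := ⟨s, hs⟩) ht hv,
      hψ.mem_of_carried (s := ⟨s, hs⟩) ht hv⟩⟩

theorem homotopic {φ : SimplicialMap K L} {g : C(Realization K, Realization L)}
    (h : IsSimplicialApproximation φ.toFun g) : φ.realization.Homotopic g := by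
  refine homotopic_of_carried fun y => ?_
  obtain ⟨t, htL, ht⟩ := exists_carried (g y)
  refine ⟨t, htL, carried_realization φ (s := {w | y.1 w ≠ 0})
    (fun w hw => Finset.mem_filter_univ _ |>.2 hw) (fun w hw => ht _ ?_), ht⟩
  exact h y w ((Finset.mem_filter_univ w).1 hw)

end IsSimplicialApproximation

/-- The vertex stars cover a realization; `δ` is a Lebesgue number of the pulled back cover. -/
theorem exists_forall_dist_lt_exists_apply_ne_zero {A : Type*} [PseudoMetricSpace A]
    [CompactSpace A] (g : C(A, Realization L)) :
    ∃ δ > 0, ∀ p, ∃ w, ∀ q, dist q p < δ → (g q).1 w ≠ 0 := by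
  have hopen (w : W) : IsOpen {p | (g p).1 w ≠ 0} :=
    isOpen_ne_fun ((continuous_coord w).comp g.continuous) continuous_const
  have hcover : (Set.univ : Set A) ⊆ ⋃ w, {p | (g p).1 w ≠ 0} := fun p _ => by
    have hsum : ∑ w, (g p).1 w ≠ 0 := (stdSimplex.sum_eq_one (g p).1).trans_ne one_ne_zero
    obtain ⟨w, -, hw⟩ := Finset.exists_ne_zero_of_sum_ne_zero hsum
    exact Set.mem_iUnion.2 ⟨w, hw⟩
  obtain ⟨δ, hδ, hball⟩ := lebesgue_number_lemma_of_metric isCompact_univ hopen hcover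
  exact ⟨δ, hδ, fun p => hball p (Set.mem_univ p)⟩

/-- A simplicial complex with vertices positioned in `|K|` and a compatible simplicial map to `K`
in the class. The iterated barycentric subdivisions are of this kind; that the induced map of
realizations is a homeomorphism is not required. -/
structure Subdivision (K : AbstractSimplicialComplex V) where
  Vert : Type u
  [fintype : Fintype Vert]
  complex : AbstractSimplicialComplex Vert
  proj : SimplicialMap complex K
  inDBar_proj : InDBar (faceSpaceMap proj)
  pos : Vert → Realization K
  exists_face : ∀ c ∈ complex, ∃ s ∈ K, ∀ w ∈ c, proj.toFun w ∈ s ∧ Carried (pos w) s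

namespace Subdivision

attribute [instance] fintype

variable (D : Subdivision K)

theorem carried_sum {y : Realization D.complex} {c : Finset D.Vert} (hy : Carried y c)
    {s : Finset V} (hs : ∀ w ∈ c, Carried (D.pos w) s) {v : V}
    (hv : ∑ w, y.1 w * (D.pos w).1 v ≠ 0) : v ∈ s := by
  obtain ⟨w, -, hw⟩ := Finset.exists_ne_zero_of_sum_ne_zero hv
  exact hs w (hy w (left_ne_zero_of_mul hw)) v (right_ne_zero_of_mul hw)

/-- The map of realizations which extends the positions of the vertices linearly. -/
noncomputable def map : C(Realization D.complex, Realization K) :=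
  ofCoords (fun y v => ∑ w, y.1 w * (D.pos w).1 v)
    (fun _ => continuous_finsetSum _ fun w _ => (continuous_coord w).mul continuous_const)
    (fun _ _ => Finset.sum_nonneg fun _ _ =>
      mul_nonneg (stdSimplex.zero_le _ _) (stdSimplex.zero_le _ _))
    (fun y => by
      rw [Finset.sum_comm]
      simp only [← Finset.mul_sum, stdSimplex.sum_eq_one, mul_one])
    fun y =>
      let ⟨c, hc, hy⟩ := exists_carried y
      let ⟨s, hs, h⟩ := D.exists_face c hc
      ⟨s, hs, fun _ => D.carried_sum hy fun w hw => (h w hw).2⟩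

theorem carried_map {y : Realization D.complex} {c : Finset D.Vert} (hy : Carried y c)
    {s : Finset V} (hs : ∀ w ∈ c, Carried (D.pos w) s) : Carried (D.map y) s :=
  fun _ => D.carried_sum hy hs

theorem map_homotopic : D.map.Homotopic D.proj.realization := by
  refine homotopic_of_carried fun y => ?_
  obtain ⟨c, hc, hy⟩ := exists_carried y
  obtain ⟨s, hs, h⟩ := D.exists_face c hc
  exact ⟨s, hs, D.carried_map hy fun w hw => (h w hw).2,
    carried_realization D.proj hy fun w hw => (h w hw).1⟩

theorem contiguous_of_isSimplicialApproximation {ψ : SimplicialMap D.complex L}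
    {φ : SimplicialMap K L} (h : IsSimplicialApproximation ψ.toFun (φ.realization.comp D.map)) :
    Contiguous ψ (φ.comp D.proj) := by
  classical
  refine contiguous_of_subset fun c hc => ?_
  obtain ⟨s, hs, hcs⟩ := D.exists_face c hc
  have hcarried : Carried (φ.realization (D.map (barycenter ⟨c, hc⟩))) (s.image φ.toFun) :=
    carried_realization φ (D.carried_map (carried_barycenter ⟨c, hc⟩) fun w hw => (hcs w hw).2)
      fun v hv => Finset.mem_image_of_mem _ hv
  exact ⟨_, φ.image_mem s hs, fun w hw => ⟨h.mem_of_carried (s := ⟨c, hc⟩) hcarried hw,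
    Finset.mem_image_of_mem _ (hcs w hw).1⟩⟩

/-- The simplices have diameter at most `ε`. -/
def MeshLE (ε : ℝ) : Prop :=
  ∀ c ∈ D.complex, ∀ w ∈ c, ∀ w' ∈ c, dist (D.pos w) (D.pos w') ≤ ε

variable {D}

theorem MeshLE.dist_map_le {ε : ℝ} (h : D.MeshLE ε) {y : Realization D.complex} {w : D.Vert}
    (hw : y.1 w ≠ 0) : dist (D.map y) (D.pos w) ≤ ε := by
  obtain ⟨c, hc, hy⟩ := exists_carried y
  have hmap : (D.map y).1.1 = ∑ w' ∈ c, y.1 w' • (D.pos w').1.1 := by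
    rw [Finset.sum_subset c.subset_univ fun w' _ hw' => by rw [hy.apply_eq_zero hw', zero_smul]]
    ext v
    rw [Finset.sum_apply]
    rfl
  have hsum : ∑ w' ∈ c, y.1 w' = 1 := by
    rw [Finset.sum_subset c.subset_univ fun w' _ hw' => hy.apply_eq_zero hw', stdSimplex.sum_eq_one]
  change dist (D.map y).1.1 (D.pos w).1.1 ≤ ε
  rw [hmap]
  exact (convex_closedBall _ _).sum_mem (fun w' _ => stdSimplex.zero_le y.1 w') hsum
    fun w' hw' => h c hc w' hw' w (hy w hw)

/-- The trivial subdivision. -/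
noncomputable def refl (K : AbstractSimplicialComplex V) : Subdivision K where
  Vert := V
  complex := K
  proj := .id K
  inDBar_proj := inDBar_faceSpaceMap_id K
  pos v := barycenter ⟨{v}, K.singleton_mem v⟩
  exists_face c hc := ⟨c, hc, fun _ hw =>
    ⟨hw, (carried_barycenter _).mono (Finset.singleton_subset_iff.2 hw)⟩⟩

theorem meshLE_refl : (refl K).MeshLE 1 := fun _ _ _ _ _ _ =>
  (dist_pi_le_iff zero_le_one).2 fun x =>
    Real.dist_le_of_mem_Icc_01 (mem_Icc_of_mem_stdSimplex (barycenter _).1.2 x)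
      (mem_Icc_of_mem_stdSimplex (barycenter _).1.2 x)

/-- The barycentric subdivision. -/
noncomputable def barycentric (D : Subdivision K) : Subdivision K where
  Vert := FaceSpace D.complex
  complex := orderComplex (FaceSpace D.complex)
  proj := D.proj.comp (subdivisionMap D.complex)
  inDBar_proj := by
    rw [faceSpaceMap_comp]
    exact D.inDBar_proj.comp inDBar_subdivisionMap
  pos s := D.map (barycenter s)
  exists_face _ hc :=
    let ⟨m, _, hm⟩ := exists_face_of_chain hc
    let ⟨s, hs, h⟩ := D.exists_face m.1 m.2
    ⟨s, hs, fun t ht => ⟨(h _ (hm t ht (chosenVertex_mem t))).1,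
      D.carried_map (carried_barycenter t) fun w hw => (h w (hm t ht hw)).2⟩⟩

theorem barycentric_pos (s : FaceSpace D.complex) :
    (D.barycentric.pos s).1.1 = (s.1.card : ℝ)⁻¹ • ∑ w ∈ s.1, (D.pos w).1.1 := by
  ext v
  change ∑ w, (barycenter s).1 w * (D.pos w).1 v = _
  rw [← Finset.sum_subset s.1.subset_univ fun w _ hw => by
    rw [(carried_barycenter s).apply_eq_zero hw, zero_mul]]
  rw [Pi.smul_apply, Finset.sum_apply, Finset.smul_sum]
  exact Finset.sum_congr rfl fun w hw => by rw [barycenter_apply_of_mem hw]; rfl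

theorem MeshLE.barycentric {ε : ℝ} (hε : 0 ≤ ε) (h : D.MeshLE ε) {n : ℕ}
    (hcard : ∀ c ∈ D.complex, c.card ≤ n) : D.barycentric.MeshLE ((1 - (n : ℝ)⁻¹) * ε) := by
  have hle (s t : FaceSpace D.complex) (hst : s ⤳ t) :
      dist (D.barycentric.pos s) (D.barycentric.pos t) ≤ (1 - (n : ℝ)⁻¹) * ε := by
    have htn : (t.1.card : ℝ) ≤ n := Nat.cast_le.2 (hcard t.1 t.2)
    have ht : (0 : ℝ) < t.1.card := Nat.cast_pos.2 (Finset.card_pos.2 t.nonempty)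
    change dist (D.barycentric.pos s).1.1 (D.barycentric.pos t).1.1 ≤ _
    rw [barycentric_pos, barycentric_pos]
    refine (dist_average_average_le (FaceSpace.specializes_iff.1 hst) s.nonempty (h t.1 t.2)).trans
      ?_
    gcongr
  intro c hc s hs t ht
  obtain hst | hts := (mem_orderComplex_iff.1 hc).2 s hs t ht
  · exact hle s t hst
  · rw [dist_comm]
    exact hle t s hts

end Subdivision

theorem card_le_of_mem_orderComplex_faceSpace {V : Type u} {K : AbstractSimplicialComplex V} {n : ℕ}
    (hK : ∀ s ∈ K, s.card ≤ n) {c : Finset (FaceSpace K)} (hc : c ∈ orderComplex (FaceSpace K)) :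
    c.card ≤ n := by
  have hinj : Set.InjOn (fun s : FaceSpace K => s.1.card) c := by
    intro s hs t ht hcard
    obtain hst | hts := (mem_orderComplex_iff.1 hc).2 s hs t ht
    · exact Subtype.ext (Finset.eq_of_subset_of_card_le (FaceSpace.specializes_iff.1 hst) hcard.ge)
    · exact (Subtype.ext
        (Finset.eq_of_subset_of_card_le (FaceSpace.specializes_iff.1 hts) hcard.le)).symm
  calc c.card ≤ (Finset.Icc 1 n).card := Finset.card_le_card_of_injOn _ (fun s _ =>
        Finset.mem_coe.2 (Finset.mem_Icc.2 ⟨Finset.card_pos.2 s.nonempty, hK s.1 s.2⟩)) hinj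
    _ = n := by rw [Nat.card_Icc, Nat.add_sub_cancel]

theorem Subdivision.exists_meshLE_pow {n : ℕ} (hK : ∀ s ∈ K, s.card ≤ n) (hn : n ≠ 0) (k : ℕ) :
    ∃ D : Subdivision K, (∀ c ∈ D.complex, c.card ≤ n) ∧ D.MeshLE ((1 - (n : ℝ)⁻¹) ^ k) := by
  induction k with
  | zero => exact ⟨refl K, hK, by rw [pow_zero]; exact meshLE_refl⟩
  | succ k ih =>
    obtain ⟨D, hcard, hmesh⟩ := ih
    refine ⟨D.barycentric, fun c hc => card_le_of_mem_orderComplex_faceSpace hcard hc, ?_⟩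
    rw [pow_succ']
    have hn : (1 : ℝ) ≤ n := Nat.one_le_cast.2 (Nat.one_le_iff_ne_zero.2 hn)
    exact hmesh.barycentric (pow_nonneg (sub_nonneg.2 (inv_le_one_of_one_le₀ hn)) k) hcard

theorem Subdivision.exists_meshLE (K : AbstractSimplicialComplex V) {ε : ℝ} (hε : 0 < ε) :
    ∃ D : Subdivision K, D.MeshLE ε := by
  have hcard : ∀ s ∈ K, s.card ≤ Fintype.card V + 1 := fun s _ =>
    (Finset.card_le_univ s).trans (Nat.le_succ _)
  obtain ⟨k, hk⟩ := exists_pow_lt_of_lt_one hε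
    (show 1 - ((Fintype.card V + 1 : ℕ) : ℝ)⁻¹ < 1 from sub_lt_self _ (by positivity))
  obtain ⟨D, -, hD⟩ := exists_meshLE_pow hcard (Nat.succ_ne_zero _) k
  exact ⟨D, fun c hc w hw w' hw' => (hD c hc w hw w' hw').trans hk.le⟩

theorem exists_simplicialApproximation {A : Type*} [PseudoMetricSpace A] [CompactSpace A]
    (H : C(A × Realization K, Realization L)) :
    ∃ (D : Subdivision K) (ψ : A → SimplicialMap D.complex L), ∃ δ > 0, ∀ a b, dist b a < δ →
      IsSimplicialApproximation (ψ a).toFun fun y => H (b, D.map y) := by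
  obtain ⟨δ, hδ, hball⟩ := exists_forall_dist_lt_exists_apply_ne_zero H
  obtain ⟨D, hD⟩ := Subdivision.exists_meshLE K (half_pos hδ)
  choose f hf using fun (a : A) (w : D.Vert) => hball (a, D.pos w)
  have happrox (a b : A) (hab : dist b a < δ) :
      IsSimplicialApproximation (f a) fun y => H (b, D.map y) := fun y w hw =>
    hf a w _ (max_lt hab ((hD.dist_map_le hw).trans_lt (half_lt_self hδ)))
  exact ⟨D, fun a => .ofSubset (f a) (happrox a a (by rwa [dist_self])).exists_image_subset,
    δ, hδ, happrox⟩

theorem exists_homotopic_realization (g : C(Realization K, Realization L)) :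
    ∃ (D : Subdivision K) (ψ : SimplicialMap D.complex L),
      ψ.realization.Homotopic (g.comp D.proj.realization) := by
  obtain ⟨D, ψ, δ, hδ, hψ⟩ := exists_simplicialApproximation (A := Unit) (g.comp .snd)
  have hψ : IsSimplicialApproximation (ψ ()).toFun (g.comp D.map) := hψ () () (by rwa [dist_self])
  exact ⟨D, ψ (), hψ.homotopic.trans (.comp (.refl g) D.map_homotopic)⟩

theorem InDBar.of_homotopic_realization {α β : SimplicialMap K L} (hα : InDBar (faceSpaceMap α))
    (h : α.realization.Homotopic β.realization) : InDBar (faceSpaceMap β) := by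
  obtain ⟨H⟩ := h
  obtain ⟨D, ψ, δ, hδ, hψ⟩ := exists_simplicialApproximation H.toContinuousMap
  have hself (t : I) : dist t t < δ := by rwa [dist_self]
  have hends {t : I} {φ : SimplicialMap K L} (hφ : ∀ x, H (t, x) = φ.realization x) :
      InDBar (faceSpaceMap (ψ t)) ↔ InDBar ((faceSpaceMap φ).comp (faceSpaceMap D.proj)) := by
    have happrox : IsSimplicialApproximation (ψ t).toFun (φ.realization.comp D.map) :=
      fun y w hw => by
        rw [ContinuousMap.comp_apply, ← hφ]
        exact hψ t t (hself t) y w hw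
    rw [(D.contiguous_of_isSimplicialApproximation happrox).inDBar_iff, faceSpaceMap_comp]
  have hconst : IsLocallyConstant fun t => InDBar (faceSpaceMap (ψ t)) := by
    refine (IsLocallyConstant.iff_eventually_eq _).2 fun t => ?_
    filter_upwards [Metric.ball_mem_nhds t hδ] with t' ht'
    exact propext ((hψ t t' ht').contiguous (hψ t' t' (hself t'))).inDBar_iff.symm
  have hzero : InDBar (faceSpaceMap (ψ 0)) :=
    (hends H.apply_zero).2 (hα.comp D.inDBar_proj)
  have hone : InDBar (faceSpaceMap (ψ 1)) := (hconst.apply_eq_of_preconnectedSpace 0 1).mp hzero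
  exact .of_comp_left D.inDBar_proj ((hends H.apply_one).1 hone)

end Approximation

/-! ### Simple homotopy equivalences lie in the class -/

section Roof

variable {V W : Type u} [Fintype V] [Fintype W] {K : AbstractSimplicialComplex V}
  {L : AbstractSimplicialComplex W}

/-- A homotopy class of maps `|K| → |L|` which is represented by simplicial maps
`K ← M → L`, both in the class. -/
def IsRoofRepresentable (g : C(Realization K, Realization L)) : Prop :=
  ∃ (U : Type u) (_ : Fintype U) (M : AbstractSimplicialComplex U) (α : SimplicialMap M K)
    (β : SimplicialMap M L), InDBar (faceSpaceMap α) ∧ InDBar (faceSpaceMap β) ∧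
      β.realization.Homotopic (g.comp α.realization)

namespace IsRoofRepresentable

variable {Z : Type u} [Fintype Z] {M : AbstractSimplicialComplex Z}
  {g : C(Realization K, Realization L)}

theorem id (K : AbstractSimplicialComplex V) :
    IsRoofRepresentable (ContinuousMap.id (Realization K)) :=
  ⟨V, inferInstance, K, .id K, .id K, inDBar_faceSpaceMap_id K, inDBar_faceSpaceMap_id K, .refl _⟩

theorem realization_comp (hg : IsRoofRepresentable g) {φ : SimplicialMap L M}
    (hφ : InDBar (faceSpaceMap φ)) : IsRoofRepresentable (φ.realization.comp g) := by
  obtain ⟨U, _, N, α, β, hα, hβ, hαβ⟩ := hg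
  refine ⟨U, inferInstance, N, α, φ.comp β, hα, ?_, ?_⟩
  · rw [faceSpaceMap_comp]
    exact hφ.comp hβ
  · rw [SimpleHomotopy.realization_comp, ContinuousMap.comp_assoc]
    exact .comp (.refl _) hαβ

/-- A simplicial approximation of `r ∘ β`, defined on a subdivision, lies in the class because its
composition with `i` is homotopic to `β`. -/
theorem rightInverse_comp (hg : IsRoofRepresentable g) {i : SimplicialMap M L}
    (hi : InDBar (faceSpaceMap i)) {r : C(Realization L, Realization M)}
    (hr : (i.realization.comp r).Homotopic (ContinuousMap.id (Realization L))) :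
    IsRoofRepresentable (r.comp g) := by
  obtain ⟨U, _, N, α, β, hα, hβ, hαβ⟩ := hg
  obtain ⟨D, ψ, hψ⟩ := exists_homotopic_realization (r.comp β.realization)
  have hiψ : (β.comp D.proj).realization.Homotopic (i.comp ψ).realization := by
    rw [SimpleHomotopy.realization_comp, SimpleHomotopy.realization_comp]
    have hcancel := hr.comp (.refl (β.realization.comp D.proj.realization))
    exact ((ContinuousMap.Homotopic.comp (.refl i.realization) hψ).trans hcancel).symm
  have hβD : InDBar (faceSpaceMap (β.comp D.proj)) := by
    rw [faceSpaceMap_comp]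
    exact hβ.comp D.inDBar_proj
  refine ⟨D.Vert, inferInstance, D.complex, α.comp D.proj, ψ, ?_, ?_, ?_⟩
  · rw [faceSpaceMap_comp]
    exact hα.comp D.inDBar_proj
  · refine .of_comp_right hi ?_
    rw [← faceSpaceMap_comp]
    exact hβD.of_homotopic_realization hiψ
  · rw [SimpleHomotopy.realization_comp]
    exact hψ.trans (.comp (.comp (.refl r) hαβ) (.refl D.proj.realization))

theorem inDBar {φ : SimplicialMap K L} (h : IsRoofRepresentable g)
    (hφ : φ.realization.Homotopic g) : InDBar (faceSpaceMap φ) := by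
  obtain ⟨U, _, N, α, β, hα, hβ, hαβ⟩ := h
  refine .of_comp_left hα ?_
  rw [← faceSpaceMap_comp]
  refine hβ.of_homotopic_realization ?_
  rw [SimpleHomotopy.realization_comp]
  exact hαβ.trans (.comp hφ.symm (.refl _))

end IsRoofRepresentable

theorem IsDeformation.isRoofRepresentable {g : C(Realization K, Realization L)}
    (hg : IsDeformation g) : IsRoofRepresentable g := by
  induction hg with
  | refl K => exact .id K
  | expansion i hi _ ih => exact ih.realization_comp hi.inDBar
  | inverse i r hi _ hr _ ih => exact ih.rightInverse_comp hi.inDBar hr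

theorem IsSimpleHomotopyEquiv.inDBar {φ : SimplicialMap K L}
    (h : IsSimpleHomotopyEquiv φ.realization) : InDBar (faceSpaceMap φ) :=
  let ⟨_, _, hg, hφg⟩ := h
  hg.isRoofRepresentable.inDBar hφg

end Roof

end SimpleHomotopy

/-- Part (a) concerns maps between finite T₀-spaces, part (b) simplicial maps between finite
simplicial complexes (with vertex sets `V` and `W`). -/
theorem mainTheorem2 :
    (∀ (X Y : Type u) [TopologicalSpace X] [Fintype X] [T0Space X]
        [TopologicalSpace Y] [Fintype Y] [T0Space Y] (f : C(X, Y)),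
        SimpleHomotopy.InDBar f ↔
          SimpleHomotopy.IsSimpleHomotopyEquiv (SimpleHomotopy.orderComplexMap f).realization) ∧
    (∀ (V W : Type u) [Fintype V] [Fintype W]
        (K : AbstractSimplicialComplex V) (L : AbstractSimplicialComplex W)
        (φ : SimpleHomotopy.SimplicialMap K L),
        SimpleHomotopy.IsSimpleHomotopyEquiv φ.realization ↔
          SimpleHomotopy.InDBar (SimpleHomotopy.faceSpaceMap φ)) :=
  ⟨fun _ _ _ _ _ _ _ _ f => ⟨fun h => h.isSimpleHomotopyEquiv, fun h =>
      (SimpleHomotopy.inDBar_iff_faceSpaceMap_orderComplexMap f).2 h.inDBar⟩,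
    fun _ _ _ _ _ _ _ => ⟨fun h => h.inDBar,
      SimpleHomotopy.isSimpleHomotopyEquiv_of_inDBar_faceSpaceMap⟩⟩
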